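/- Let $m,k\ge 1$ be integers. Let $S$ be the unit hypercube $[0,1)^m$ regarded as a torus, equipped with the torus metric derived from the Euclidean norm, or with any equivalent metric (one that induces the same topology and for which there is a ball of every prescribed volume in $(0,1)$ around every point). Divide $S$ into the $k^m$ hypercubes $\mathcal R_\ell = I_{j_1}\times\dots\times I_{j_m}$, $0\le j_1,\dots,j_m<k$, where $I_j=[j/k,(j+1)/k)$. Let $\rho_\ell\ge 0$ be densities with $\sum_\ell q_\ell=1$, where $q_\ell=\rho_\ell k^{-m}$, and let $\rho$ be the density function on $S$ with value $\rho_\ell$ on $\mathcal R_\ell$. Let $A_1,A_2>0$ and $p\in(0,1)$ satisfy $pA_1\max_\ell\rho_\ell<1$. All these parameters are fixed. The inhomogeneous SPA model generates random directed graphs $(G_t)_{t\ge 0}$ as follows. $G_0$ is the null graph. At each time step $t\ge1$ a new node $v_t\in S$ is chosen with density $\rho$, independently of the past, and then, independently for each earlier node $u$ with $v_t\in S(u,t-1)$, a directed link $(v_t,u)$ is created with probability $p$. Here the sphere of influence $S(u,t)$ is the ball centred at $u$ of volume $(A_1\deg^-(u,t)+A_2)/t$, where $\deg^-(u,t)$ is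 the in-degree of $u$ in $G_t$, and $S(u,t)=S$ if this number is at least $1$. For a node $v$ let $\mathcal R(v)$ be the hypercube containing $v$. An event holds asymptotically almost surely (a.a.s.) if its probability tends to $1$ as $n\to\infty$; $o(\cdot)$ refers to $n\to\infty$. Then: 1. A.a.s., for all regions $\mathcal R_\ell$, $|V(G_n)\cap\mathcal R_\ell|=(1+o(1))\,q_\ell n$. 2. For every region $\mathcal R_\ell$, $$\mathbb E\bigl(|\{(u,v)\in E(G_n) : u,v\in\mathcal R_\ell\}|\bigr)=(1+o(1))\,\frac{p\rho_\ell A_2}{1-p\rho_\ell A_1}\,q_\ell n.$$ 3. A.a.s. $|\{(u,v)\in E(G_n):\mathcal R(u)\ne\mathcal R(v)\}|=o(n)$. -/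

import Mathlib

open MeasureTheory Filter Topology Set

namespace SPA

/-- The torus obtained from the unit hypercube `[0,1)^m` by identifying opposite faces. Its
`volume` is the Lebesgue (Haar) probability measure. -/
abbrev Torus (m : ℕ) : Type := Fin m → UnitAddCircle

/-- A metric on the torus that is equivalent to the Euclidean torus metric, i.e. induces the same
topology (the torus being compact Hausdorff, a metric does so as soon as it is continuous), and for
which balls of any prescribed volume around any point exist. -/
structure TorusMetric (m : ℕ) where
  dist : Torus m → Torus m → ℝ
  dist_eq_zero_iff : ∀ x y, dist x y = 0 ↔ x = y
  dist_comm : ∀ x y, dist x y = dist y x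
  dist_triangle : ∀ x y z, dist x z ≤ dist x y + dist y z
  continuous_dist : Continuous (fun z : Torus m × Torus m => dist z.1 z.2)
  exists_ball : ∀ (x : Torus m) (a : ℝ), 0 < a → a < 1 →
    ∃ r : ℝ, volume.real {y | dist x y ≤ r} = a

noncomputable section

/-- The radius of the ball of volume `a` centred at `x`, for `0 < a < 1`. -/
def TorusMetric.radius {m : ℕ} (d : TorusMetric m) (x : Torus m) (a : ℝ) : ℝ :=
  sInf {r : ℝ | a ≤ volume.real {y | d.dist x y ≤ r}}

/-- The ball centred at `x` with total volume `a`; it is the whole space if `1 ≤ a`. -/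
def TorusMetric.ballOfVolume {m : ℕ} (d : TorusMetric m) (x : Torus m) (a : ℝ) :
    Set (Torus m) :=
  {y | 1 ≤ a ∨ d.dist x y ≤ d.radius x a}

/-- The hypercube `I_{ℓ_1} × ⋯ × I_{ℓ_m}` with `I_j = [j/k, (j+1)/k)`, as a subset of the torus. -/
def region {m k : ℕ} (ℓ : Fin m → Fin k) : Set (Torus m) :=
  Set.univ.pi fun i =>
    (fun y : ℝ => (y : UnitAddCircle)) '' Set.Ico (((ℓ i : ℕ) : ℝ) / k) ((((ℓ i : ℕ) : ℝ) + 1) / k)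

/-- The parameters of the inhomogeneous SPA model with a locally constant density: `ρ ℓ` is the
density of the hypercube `region ℓ`. -/
structure Model where
  m : ℕ
  m_pos : 0 < m
  metric : TorusMetric m
  k : ℕ
  k_pos : 0 < k
  ρ : (Fin m → Fin k) → ℝ
  ρ_nonneg : ∀ ℓ, 0 ≤ ρ ℓ
  sum_ρ : ∑ ℓ, ρ ℓ * ((k : ℝ) ^ m)⁻¹ = 1
  A₁ : ℝ
  A₂ : ℝ
  p : ℝ
  A₁_pos : 0 < A₁
  A₂_pos : 0 < A₂
  p_pos : 0 < p
  p_lt_one : p < 1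
  subcritical : ∀ ℓ, p * A₁ * ρ ℓ < 1

namespace Model


variable (M : Model)

/-- Labels of the `k^m` regions. -/
abbrev Label : Type := Fin M.m → Fin M.k

/-- `q_ℓ = ρ_ℓ k^{-m}`. -/
def q (ℓ : M.Label) : ℝ := M.ρ ℓ * ((M.k : ℝ) ^ M.m)⁻¹

/-- The locally constant density function on the torus. -/
def density (x : Torus M.m) : ℝ :=
  ∑ ℓ : M.Label, (region ℓ).indicator (fun _ => M.ρ ℓ) x

/-- The law of the position of a node. -/
def nodeLaw : Measure (Torus M.m) :=
  volume.withDensity fun x => ENNReal.ofReal (M.density x)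

/-- The law of a coin that shows `true` with probability `p`. -/
def coinLaw : Measure Bool :=
  ENNReal.ofReal M.p • Measure.dirac true + ENNReal.ofReal (1 - M.p) • Measure.dirac false

/-- A sample: the positions of the nodes `v_t`, and for each pair `(t, i)` the coin that decides
whether `v_t` links to `v_i` if it falls in the sphere of influence of `v_i`. -/
abbrev Sample : Type := (ℕ → Torus M.m) × (ℕ × ℕ → Bool)

/-- The probability measure of the model: all positions and all coins are independent. -/
def law : Measure M.Sample :=
  (Measure.infinitePi fun _ : ℕ => M.nodeLaw).prod (Measure.infinitePi fun _ : ℕ × ℕ => M.coinLaw)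

/-- The in-degree of node `i` in a set of directed links. -/
def inDeg (E : Finset (ℕ × ℕ)) (i : ℕ) : ℕ := (E.filter fun e => e.2 = i).card

/-- The sphere of influence at time `t` of a node located at `x` that has in-degree `j`: the ball
centred at `x` of volume `(A₁ j + A₂) / t`. -/
def sphere (x : Torus M.m) (j t : ℕ) : Set (Torus M.m) :=
  M.metric.ballOfVolume x ((M.A₁ * j + M.A₂) / t)

open Classical in
/-- The links of the graph `G_t` on the nodes `v_1, …, v_t`; the node `v_i` is represented by its
index `i`, and the link `(v_s, v_i)` by `(s, i)`. -/
def edges (ω : M.Sample) : ℕ → Finset (ℕ × ℕ)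
  | 0 => ∅
  | t + 1 => edges ω t ∪
      ((Finset.Icc 1 t).filter fun i =>
        ω.1 (t + 1) ∈ M.sphere (ω.1 i) (inDeg (edges ω t) i) t ∧ ω.2 (t + 1, i) = true).image
        fun i => (t + 1, i)

open Classical in
/-- The number of nodes of `G_n` in the region `ℓ`. -/
def nodeCount (ω : M.Sample) (n : ℕ) (ℓ : M.Label) : ℕ :=
  ((Finset.Icc 1 n).filter fun i => ω.1 i ∈ region ℓ).card

open Classical in
/-- The number of links of `G_n` with both endpoints in the region `ℓ`. -/
def innerEdgeCount (ω : M.Sample) (n : ℕ) (ℓ : M.Label) : ℕ :=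
  ((M.edges ω n).filter fun e => ω.1 e.1 ∈ region ℓ ∧ ω.1 e.2 ∈ region ℓ).card

open Classical in
/-- The number of links of `G_n` whose endpoints are not in a common region. -/
def crossingEdgeCount (ω : M.Sample) (n : ℕ) : ℕ :=
  ((M.edges ω n).filter fun e =>
    ¬ ∃ ℓ : M.Label, ω.1 e.1 ∈ region ℓ ∧ ω.1 e.2 ∈ region ℓ).card

/-- The events `E n` hold asymptotically almost surely. -/
def AAS (E : ℕ → Set M.Sample) : Prop :=
  Tendsto (fun n => M.law (E n)) atTop (𝓝 1)

end Model

end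

end SPA

namespace SPA

noncomputable section

theorem exists_real_Iic_eq (ν : Measure ℝ) [IsProbabilityMeasure ν]
    (h0 : ∀ r, ν {r} = 0) (a : ℝ) (ha0 : 0 < a) (ha1 : a < 1) : ∃ r, ν.real (Set.Iic r) = a := by
  have hc : Continuous (ProbabilityTheory.cdf ν) := by
    rw [continuous_iff_continuousAt]
    intro r
    rw [(ProbabilityTheory.monotone_cdf ν).continuousAt_iff_leftLim_eq_rightLim,
      StieltjesFunction.rightLim_eq]
    have h := StieltjesFunction.measure_singleton (ProbabilityTheory.cdf ν) r
    rw [ProbabilityTheory.measure_cdf, h0] at h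
    have h2 := ENNReal.ofReal_eq_zero.1 h.symm
    have h3 := (ProbabilityTheory.monotone_cdf ν).leftLim_le (le_refl r)
    linarith
  have e0 : ∃ r, ProbabilityTheory.cdf ν r ≤ a :=
    (((ProbabilityTheory.tendsto_cdf_atBot ν).eventually (gt_mem_nhds ha0)).exists).imp
      fun _ h => le_of_lt h
  have e1 : ∃ r, a ≤ ProbabilityTheory.cdf ν r :=
    (((ProbabilityTheory.tendsto_cdf_atTop ν).eventually (lt_mem_nhds ha1)).exists).imp
      fun _ h => le_of_lt h
  obtain ⟨r, hr⟩ := mem_range_of_exists_le_of_exists_ge hc e0 e1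
  exact ⟨r, by rw [← ProbabilityTheory.cdf_eq_real]; exact hr⟩

theorem finite_norm_eq (x : UnitAddCircle) (c : ℝ) :
    {a : UnitAddCircle | ‖x - a‖ ^ 2 = c}.Finite := by
  have key : ∀ u : UnitAddCircle, u = ((‖u‖ : ℝ) : UnitAddCircle) ∨
      u = ((-‖u‖ : ℝ) : UnitAddCircle) := by
    intro u
    induction u using QuotientAddGroup.induction_on with
    | H t =>
      have hz : ((t - round t : ℝ) : UnitAddCircle) = (t : UnitAddCircle) := by
        rw [← sub_eq_zero, ← AddCircle.coe_sub, AddCircle.coe_eq_zero_iff]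
        exact ⟨-round t, by simp⟩
      rw [show (QuotientAddGroup.mk t : UnitAddCircle) = (t : UnitAddCircle) from rfl,
        UnitAddCircle.norm_eq]
      rcases abs_choice (t - round t) with h | h <;> rw [h]
      · left; exact hz.symm
      · right; rw [neg_neg]; exact hz.symm
  refine (Set.toFinite {x - ((Real.sqrt c : ℝ) : UnitAddCircle),
    x - ((-Real.sqrt c : ℝ) : UnitAddCircle)}).subset ?_
  intro a ha
  have hs : ‖x - a‖ = Real.sqrt c := by
    rw [← (show ‖x - a‖ ^ 2 = c from ha), Real.sqrt_sq (norm_nonneg _)]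
  have h := key (x - a)
  rw [hs] at h
  rcases h with h | h
  · left; rw [← h]; abel
  · right; rw [Set.mem_singleton_iff, ← h]; abel

theorem volume_sphere_eq_zero {m : ℕ} (hm : 0 < m) (x : Torus m) (c : ℝ) :
    volume {y : Torus m | ∑ i, ‖x i - y i‖ ^ 2 = c} = 0 := by
  obtain ⟨n, rfl⟩ : ∃ n, m = n + 1 := ⟨m - 1, by omega⟩
  have hmeas : MeasurableSet {y : Torus (n + 1) | ∑ i, ‖x i - y i‖ ^ 2 = c} :=
    (isClosed_eq (by fun_prop) continuous_const).measurableSet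
  have mp := (volume_preserving_piFinSuccAbove (fun _ : Fin (n + 1) => UnitAddCircle) 0).symm
  rw [← mp.measure_preimage hmeas.nullMeasurableSet, Measure.volume_eq_prod,
    Measure.prod_apply_symm (mp.measurable hmeas)]
  refine (lintegral_congr fun b => ?_).trans lintegral_zero
  have hpt : ∀ u : UnitAddCircle, volume {u} = 0 := fun u => by
    rw [← Metric.closedBall_zero (x := u), AddCircle.volume_closedBall]; simp
  have hfin := finite_norm_eq (x 0) (c - ∑ i : Fin n, ‖x i.succ - b i‖ ^ 2)
  refine measure_mono_null ?_ ((measure_biUnion_null_iff hfin.countable).2 fun u _ => hpt u)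
  rw [Set.biUnion_of_singleton]
  intro a ha
  have h : ∑ i, ‖x i - (Fin.insertNth (0 : Fin (n + 1)) a b : Torus (n + 1)) i‖ ^ 2 = c := ha
  rw [Fin.sum_univ_succ] at h
  simp only [Fin.insertNth_zero', Fin.cons_zero, Fin.cons_succ] at h
  exact eq_sub_of_add_eq h

/-- The torus metric derived from the Euclidean norm. -/
def euclideanMetric (m : ℕ) (hm : 0 < m) : TorusMetric m where
  dist x y := Real.sqrt (∑ i, ‖x i - y i‖ ^ 2)
  dist_eq_zero_iff x y := by
    rw [Real.sqrt_eq_zero (by positivity), Finset.sum_eq_zero_iff_of_nonneg (by intros; positivity)]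
    simp [sub_eq_zero, funext_iff]
  dist_comm x y := by simp only [norm_sub_rev]
  dist_triangle x y z := by
    have h := norm_add_le (WithLp.toLp 2 (fun i => ‖x i - y i‖) : EuclideanSpace ℝ (Fin m))
      (WithLp.toLp 2 (fun i => ‖y i - z i‖))
    simp only [EuclideanSpace.norm_eq, PiLp.add_apply, Real.norm_eq_abs, sq_abs] at h
    refine le_trans (Real.sqrt_le_sqrt (Finset.sum_le_sum fun i _ => ?_)) h
    gcongr
    simpa using norm_add_le (x i - y i) (y i - z i)
  continuous_dist := by fun_prop
  exists_ball x a h0 h1 := by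
    have hf : Continuous fun y : Torus m => Real.sqrt (∑ i, ‖x i - y i‖ ^ 2) := by fun_prop
    have : IsProbabilityMeasure (volume : Measure (Torus m)) := ⟨by
      rw [← Set.pi_univ Set.univ, volume_pi_pi]; simp⟩
    have : IsProbabilityMeasure (volume.map fun y : Torus m =>
        Real.sqrt (∑ i, ‖x i - y i‖ ^ 2)) := Measure.isProbabilityMeasure_map hf.aemeasurable
    obtain ⟨r, hr⟩ := exists_real_Iic_eq (volume.map fun y : Torus m =>
        Real.sqrt (∑ i, ‖x i - y i‖ ^ 2)) (fun r => by
      rw [Measure.map_apply hf.measurable (measurableSet_singleton r)]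
      refine measure_mono_null (fun y hy => ?_) (volume_sphere_eq_zero hm x (r ^ 2))
      have hy' : Real.sqrt (∑ i, ‖x i - y i‖ ^ 2) = r := hy
      rw [Set.mem_ofPred_eq, ← hy', Real.sq_sqrt (by positivity)]) a h0 h1
    refine ⟨r, ?_⟩
    rw [← hr, map_measureReal_apply hf.measurable measurableSet_Iic]
    rfl

theorem coe_injOn : Set.InjOn (fun y : ℝ => (y : UnitAddCircle)) (Set.Ico 0 1) := by
  intro a ha b hb h
  have := (AddCircle.coe_eq_coe_iff_of_mem_Ico (p := (1:ℝ)) (a := 0) (by simpa using ha) (by simpa using hb)).1 h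
  exact this

theorem measurableSet_arc (a b : ℝ) (h0 : 0 ≤ a) (h1 : b ≤ 1) :
    MeasurableSet ((fun y : ℝ => (y : UnitAddCircle)) '' Set.Ico a b) :=
  measurableSet_Ico.image_of_measurable_injOn AddCircle.measurable_mk'
    (coe_injOn.mono (Set.Ico_subset_Ico h0 h1))

theorem volume_arc (a b : ℝ) (h0 : 0 ≤ a) (h1 : b ≤ 1) :
    volume ((fun y : ℝ => (y : UnitAddCircle)) '' Set.Ico a b) = ENNReal.ofReal (b - a) := by
  rw [AddCircle.add_projection_respects_measure 1 0 (measurableSet_arc a b h0 h1)]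
  apply le_antisymm
  · calc _ ≤ volume (Set.Icc a b ∪ {1}) := measure_mono ?_
      _ ≤ volume (Set.Icc a b) + volume {(1 : ℝ)} := measure_union_le _ _
      _ = _ := by simp
    rintro t ⟨⟨s, hs, hst⟩, ht0, ht1⟩
    rw [zero_add] at ht1
    rcases ht1.eq_or_lt with h | h
    · exact Or.inr h
    · left
      have : s = t := coe_injOn ⟨h0.trans hs.1, hs.2.trans_le h1⟩ ⟨ht0.le, h⟩ hst
      exact this ▸ ⟨hs.1, hs.2.le⟩
  · rw [← Real.volume_Ioo]
    refine measure_mono fun t ht => ⟨⟨t, ⟨ht.1.le, ht.2⟩, rfl⟩, h0.trans_lt ht.1, ?_⟩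
    rw [zero_add]
    exact (ht.2.trans_le h1).le

theorem label_bounds {k : ℕ} (j : Fin k) :
    (0 : ℝ) ≤ ((j : ℕ) : ℝ) / k ∧ (((j : ℕ) : ℝ) + 1) / k ≤ 1 := by
  have hk : (0 : ℝ) < k := by exact_mod_cast j.pos
  refine ⟨by positivity, ?_⟩
  rw [div_le_one hk]
  exact_mod_cast j.isLt

theorem measurableSet_region {m k : ℕ} (ℓ : Fin m → Fin k) : MeasurableSet (region ℓ) :=
  MeasurableSet.univ_pi fun i => measurableSet_arc _ _ (label_bounds (ℓ i)).1 (label_bounds (ℓ i)).2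

theorem volume_region {m k : ℕ} (ℓ : Fin m → Fin k) :
    volume (region ℓ) = ENNReal.ofReal (((k : ℝ) ^ m)⁻¹) := by
  rw [region, volume_pi_pi]
  simp_rw [fun i => volume_arc _ _ (label_bounds (ℓ i)).1 (label_bounds (ℓ i)).2]
  rw [← ENNReal.ofReal_prod_of_nonneg]
  · simp [← sub_div]
  · intro i _
    rw [← sub_div]; simp

theorem existsUnique_region {m k : ℕ} (hk : 0 < k) (x : Torus m) :
    ∃! ℓ : Fin m → Fin k, x ∈ region ℓ := by
  have hk' : (0 : ℝ) < k := by exact_mod_cast hk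
  have h : ∀ u : UnitAddCircle, ∃! j : Fin k, u ∈ (fun y : ℝ => (y : UnitAddCircle)) ''
      Set.Ico (((j : ℕ) : ℝ) / k) ((((j : ℕ) : ℝ) + 1) / k) := by
    intro u
    obtain ⟨y, hy, rfl⟩ : ∃ y ∈ Set.Ico (0 : ℝ) 1, (y : UnitAddCircle) = u := by
      have := AddCircle.coe_image_Ico_eq (1 : ℝ) 0
      rw [zero_add] at this
      exact (Set.ext_iff.1 this u).2 trivial
    have hlt : ⌊(k : ℝ) * y⌋₊ < k := by
      rw [Nat.floor_lt (mul_nonneg hk'.le hy.1)]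
      nlinarith [hy.2]
    refine ⟨⟨_, hlt⟩, ⟨y, ⟨?_, ?_⟩, rfl⟩, ?_⟩
    · rw [div_le_iff₀ hk', mul_comm y]
      exact Nat.floor_le (mul_nonneg hk'.le hy.1)
    · rw [lt_div_iff₀ hk', mul_comm y]
      exact Nat.lt_floor_add_one _
    · rintro j ⟨z, hz, hzy⟩
      have hzy' : z = y := coe_injOn ⟨(label_bounds j).1.trans hz.1,
        hz.2.trans_le (label_bounds j).2⟩ hy hzy
      subst hzy'
      apply Fin.ext
      symm
      rw [Nat.floor_eq_iff (mul_nonneg hk'.le hy.1)]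
      have h1 := hz.1
      have h2 := hz.2
      rw [div_le_iff₀ hk'] at h1
      rw [lt_div_iff₀ hk'] at h2
      constructor <;> linarith
  choose f hf hu using h
  refine ⟨fun i => f (x i), fun i _ => hf (x i), fun ℓ hℓ => funext fun i => hu _ _ (hℓ i trivial)⟩

namespace Model

variable (M : Model)

instance : IsProbabilityMeasure M.coinLaw := ⟨by
  simp only [coinLaw, Measure.add_apply, Measure.smul_apply, measure_univ, smul_eq_mul, mul_one]
  rw [← ENNReal.ofReal_add M.p_pos.le (by linarith [M.p_lt_one])]
  simp⟩

instance : IsProbabilityMeasure M.nodeLaw := ⟨by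
  rw [nodeLaw, withDensity_apply _ MeasurableSet.univ, Measure.restrict_univ]
  have h : ∀ x, ENNReal.ofReal (M.density x) =
      ∑ ℓ : M.Label, (region ℓ).indicator (fun _ => ENNReal.ofReal (M.ρ ℓ)) x := by
    intro x
    rw [density, ENNReal.ofReal_sum_of_nonneg
      (fun ℓ _ => Set.indicator_nonneg (fun _ _ => M.ρ_nonneg ℓ) x)]
    refine Finset.sum_congr rfl fun ℓ _ => ?_
    by_cases hx : x ∈ region ℓ <;> simp [hx]
  simp_rw [h]
  rw [lintegral_finsetSum _
    (fun ℓ _ => measurable_const.indicator (measurableSet_region ℓ))]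
  simp_rw [lintegral_indicator_const (measurableSet_region _), volume_region,
    ← ENNReal.ofReal_mul (M.ρ_nonneg _)]
  rw [← ENNReal.ofReal_sum_of_nonneg
    (fun ℓ _ => mul_nonneg (M.ρ_nonneg ℓ) (by positivity)), M.sum_ρ, ENNReal.ofReal_one]⟩

instance : IsProbabilityMeasure M.law := by unfold law; infer_instance

end Model
end
end SPA

/-!
If the sphere of influence of a node stays inside its region `ℓ`, the next node falls into it with
probability `ρ_ℓ (A₁ deg + A₂) / t`, so the mean total weight `∑ (A₁ deg + A₂)` over a region would
satisfy an exact linear recursion whose solution grows like `A₂ q_ℓ / (1 - p A₁ ρ_ℓ) * t`. The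
error comes from spheres that leave their regions. A large sphere is paid for by the mean sum of
squared weights, which is `o(t²)` because `p A₁ max ρ < 1`; a small one leaves its region only if
its centre is close to a region boundary, and the mean total weight of the nodes in a set `B` is at
most a constant times `nodeLaw B * t`, which is small for a thin neighbourhood of the boundaries.
Hence the mean volume that the spheres occupy outside the regions of their centres tends to `0`.
This gives the expected number of inner links and, through Markov's inequality, the bound on
crossing links; the node counts follow from the strong law of large numbers.
-/

namespace SPA

/-! ### Linear recursions -/

theorem tendsto_zero_of_le_one_sub_mul {z a : ℕ → ℝ} (hz : ∀ n, 0 ≤ z n)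
    (ha : Tendsto (fun n => ∑ i ∈ Finset.range n, a i) atTop atTop)
    (hrec : ∀ᶠ n in atTop, z (n + 1) ≤ (1 - a n) * z n) : Tendsto z atTop (𝓝 0) := by
  obtain ⟨N, hN⟩ := eventually_atTop.1 hrec
  set s : ℕ → ℝ := fun n => ∑ i ∈ Finset.range n, a i
  have hbound : ∀ n ≥ N, z n ≤ z N * Real.exp (s N) * Real.exp (-s n) := by
    intro n hn
    induction n, hn using Nat.le_induction with
    | base => rw [mul_assoc, ← Real.exp_add, add_neg_cancel, Real.exp_zero, mul_one]
    | succ n hn ih =>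
      calc z (n + 1) ≤ (1 - a n) * z n := hN n hn
        _ ≤ Real.exp (-a n) * z n :=
          mul_le_mul_of_nonneg_right (Real.one_sub_le_exp_neg (a n)) (hz n)
        _ ≤ Real.exp (-a n) * (z N * Real.exp (s N) * Real.exp (-s n)) := by gcongr
        _ = z N * Real.exp (s N) * Real.exp (-s (n + 1)) := by
          rw [show s (n + 1) = s n + a n from Finset.sum_range_succ a n, neg_add, Real.exp_add]
          ring
  have hlim : Tendsto (fun n => z N * Real.exp (s N) * Real.exp (-s n)) atTop (𝓝 0) := by
    simpa only [mul_zero, Function.comp_def] using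
      (Real.tendsto_exp_neg_atTop_nhds_zero.comp ha).const_mul (z N * Real.exp (s N))
  exact squeeze_zero' (Eventually.of_forall hz) (eventually_atTop.2 ⟨N, hbound⟩) hlim

theorem tendsto_zero_of_le_one_sub_mul_add {z a δ : ℕ → ℝ} (hz : ∀ n, 0 ≤ z n)
    (ha : Tendsto (fun n => ∑ i ∈ Finset.range n, a i) atTop atTop)
    (ha' : ∀ᶠ n in atTop, a n ∈ Icc 0 1) (hδ : Tendsto δ atTop (𝓝 0))
    (hrec : ∀ᶠ n in atTop, z (n + 1) ≤ (1 - a n) * z n + a n * δ n) :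
    Tendsto z atTop (𝓝 0) := by
  have hexcess : ∀ r > 0, Tendsto (fun n => max (z n - r) 0) atTop (𝓝 0) := by
    refine fun r hr => tendsto_zero_of_le_one_sub_mul (fun n => le_max_right _ _) ha ?_
    filter_upwards [ha', hδ.eventually_le_const hr, hrec] with n ⟨ha0, ha1⟩ hδr hn
    have hmax : (1 - a n) * (z n - r) ≤ (1 - a n) * max (z n - r) 0 :=
      mul_le_mul_of_nonneg_left (le_max_left _ _) (sub_nonneg.2 ha1)
    have hδr' : a n * δ n ≤ a n * r := mul_le_mul_of_nonneg_left hδr ha0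
    exact max_le (by linarith) (mul_nonneg (sub_nonneg.2 ha1) (le_max_right _ _))
  refine tendsto_order.2 ⟨fun b hb => Eventually.of_forall fun n => hb.trans_le (hz n),
    fun b hb => ?_⟩
  filter_upwards [(hexcess (b / 2) (half_pos hb)).eventually_lt_const (half_pos hb)] with n hn
  linarith [le_max_left (z n - b / 2) 0]

theorem tendsto_div_zero_of_le {x ε : ℕ → ℝ} {c : ℝ} (hx : ∀ t, 0 ≤ x t) (hc : c < 1)
    (hε : Tendsto ε atTop (𝓝 0))
    (hrec : ∀ᶠ t : ℕ in atTop, x (t + 1) ≤ (1 + c / t) * x t + ε t) :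
    Tendsto (fun t : ℕ => x t / t) atTop (𝓝 0) := by
  have hc' : 0 < 1 - c := sub_pos.2 hc
  refine tendsto_zero_of_le_one_sub_mul_add (a := fun t => (1 - c) * (1 / ((t : ℝ) + 1)))
    (δ := fun t => ε t / (1 - c)) (fun t => div_nonneg (hx t) t.cast_nonneg) ?_ ?_
    (by simpa using hε.div_const (1 - c)) ?_
  · simp_rw [← Finset.mul_sum]
    exact Real.tendsto_sum_range_one_div_nat_succ_atTop.const_mul_atTop hc'
  · have h0 : Tendsto (fun t : ℕ => (1 - c) * (1 / ((t : ℝ) + 1))) atTop (𝓝 0) := by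
      simpa using tendsto_one_div_add_atTop_nhds_zero_nat.const_mul (1 - c)
    filter_upwards [h0.eventually_le_const one_pos] with t ht using ⟨by positivity, ht⟩
  · filter_upwards [hrec, eventually_gt_atTop 0] with t ht ht0
    have : (0 : ℝ) < t := Nat.cast_pos.2 ht0
    rw [Nat.cast_add_one, div_le_iff₀ (by positivity)]
    refine ht.trans_eq ?_
    field_simp
    ring

theorem tendsto_div_sq_zero_of_le {x : ℕ → ℝ} {c D : ℝ} (hx : ∀ t, 0 ≤ x t) (hc : c < 2)
    (hrec : ∀ᶠ t : ℕ in atTop, x (t + 1) ≤ (1 + c / t) * x t + D) :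
    Tendsto (fun t : ℕ => x t / (t : ℝ) ^ 2) atTop (𝓝 0) := by
  have hdiv : Tendsto (fun t : ℕ => x t / t / t) atTop (𝓝 0) := by
    refine tendsto_div_zero_of_le (c := c / 2) (ε := fun t => D * (1 / ((t : ℝ) + 1)))
      (fun t => div_nonneg (hx t) t.cast_nonneg) (by linarith)
      (by simpa using tendsto_one_div_add_atTop_nhds_zero_nat.const_mul D) ?_
    filter_upwards [hrec, eventually_gt_atTop 0,
      tendsto_natCast_atTop_atTop.eventually_ge_atTop (-c / (2 - c))] with t ht ht0 htc
    have ht0' : (0 : ℝ) < t := Nat.cast_pos.2 ht0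
    have hfactor : (1 + c / t) * t / (t + 1) ≤ 1 + c / 2 / t := by
      rw [div_le_iff₀ (by linarith)] at htc
      rw [div_le_iff₀ (by positivity), ← sub_nonneg]
      have : (1 + c / 2 / t) * (t + 1) - (1 + c / t) * t = ((2 - c) * t + c) / (2 * t) := by
        field_simp
        ring
      rw [this]
      exact div_nonneg (by linarith) (by positivity)
    calc x (t + 1) / ((t + 1 : ℕ) : ℝ) ≤ ((1 + c / t) * x t + D) / (t + 1) := by
          rw [Nat.cast_add_one]; gcongr
      _ = (1 + c / t) * t / (t + 1) * (x t / t) + D * (1 / ((t : ℝ) + 1)) := by field_simp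
      _ ≤ (1 + c / 2 / t) * (x t / t) + D * (1 / ((t : ℝ) + 1)) := by
          have := div_nonneg (hx t) ht0'.le
          gcongr
  exact hdiv.congr fun t => by rw [div_div, sq]

theorem tendsto_div_of_tendsto_sub {x : ℕ → ℝ} {b c : ℝ} (hc : c < 1)
    (h : Tendsto (fun t : ℕ => x (t + 1) - (1 + c / t) * x t) atTop (𝓝 b)) :
    Tendsto (fun t : ℕ => x t / t) atTop (𝓝 (b / (1 - c))) := by
  set s := b / (1 - c)
  have hb : s * (1 - c) = b := div_mul_cancel₀ b (sub_ne_zero.2 hc.ne')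
  have hdev : Tendsto (fun t : ℕ => |x t - s * t| / t) atTop (𝓝 0) := by
    refine tendsto_div_zero_of_le (c := c) (ε := fun t => |x (t + 1) - (1 + c / t) * x t - b|)
      (fun t => abs_nonneg _) hc ?_ ?_
    · simpa using (h.sub_const b).abs
    · have hpos : Tendsto (fun t : ℕ => 1 + c / t) atTop (𝓝 1) := by
        simpa using (tendsto_const_div_atTop_nhds_zero_nat c).const_add 1
      filter_upwards [eventually_gt_atTop 0, hpos.eventually_const_le one_pos] with t ht0 ht
      have ht0' : (t : ℝ) ≠ 0 := Nat.cast_ne_zero.2 ht0.ne'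
      have heq : x (t + 1) - s * ((t + 1 : ℕ) : ℝ) =
          (1 + c / t) * (x t - s * t) + (x (t + 1) - (1 + c / t) * x t - b) := by
        rw [← hb, Nat.cast_add_one]
        field_simp
        ring
      rw [heq]
      exact (abs_add_le _ _).trans_eq (by rw [abs_mul, abs_of_nonneg ht])
  have hlim : Tendsto (fun t : ℕ => (x t - s * t) / t) atTop (𝓝 0) :=
    (tendsto_zero_iff_abs_tendsto_zero _).2 <| hdev.congr fun t => by
      simp only [Function.comp_apply, abs_div, Nat.abs_cast]
  have hadd := hlim.add_const s
  rw [zero_add] at hadd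
  refine hadd.congr' ?_
  filter_upwards [eventually_gt_atTop 0] with t ht0
  have ht0' : (t : ℝ) ≠ 0 := Nat.cast_ne_zero.2 ht0.ne'
  field_simp
  ring

theorem isEquivalent_mul_natCast_of_tendsto_div {x : ℕ → ℝ} {c : ℝ} (hc : c ≠ 0)
    (h : Tendsto (fun n : ℕ => x n / n) atTop (𝓝 c)) :
    Asymptotics.IsEquivalent atTop x (fun n : ℕ => c * n) := by
  refine (((Asymptotics.isEquivalent_const_iff_tendsto hc).2 h).mul
    (Asymptotics.IsEquivalent.refl (u := fun n : ℕ => (n : ℝ)))).congr_left ?_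
  filter_upwards [eventually_ne_atTop 0] with n hn
  exact div_mul_cancel₀ _ (Nat.cast_ne_zero.2 hn)

/-! ### Finite and product measures -/

theorem le_measureReal_le_sInf {α : Type*} [MeasurableSpace α] {μ : Measure α} [IsFiniteMeasure μ]
    {f : α → ℝ} (hf : Measurable f) {a : ℝ} (hne : {r | a ≤ μ.real {y | f y ≤ r}}.Nonempty) :
    a ≤ μ.real {y | f y ≤ sInf {r | a ≤ μ.real {y | f y ≤ r}}} := by
  set R := sInf {r | a ≤ μ.real {y | f y ≤ r}}
  have hgt : ∀ r, R < r → a ≤ μ.real {y | f y ≤ r} := by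
    intro r hr
    obtain ⟨s, hs, hsr⟩ := exists_lt_of_csInf_lt hne hr
    exact le_trans hs (measureReal_mono fun y hy => le_trans hy hsr.le)
  have hInter : (⋂ r, ⋂ (_ : r > R), {y | f y ≤ r}) = {y | f y ≤ R} := by
    ext y
    simp only [mem_iInter]
    exact ⟨fun h => le_of_forall_gt_imp_ge_of_dense h, fun h r hr => le_trans h hr.le⟩
  have hlim := tendsto_measure_biInter_gt (μ := μ) (a := R) (s := fun r => {y | f y ≤ r})
    (fun r _ => (measurableSet_le hf measurable_const).nullMeasurableSet)
    (fun i j _ hij y hy => le_trans hy hij) ⟨R + 1, by simp, measure_ne_top _ _⟩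
  rw [hInter] at hlim
  refine ge_of_tendsto ((ENNReal.tendsto_toReal (measure_ne_top _ _)).comp hlim) ?_
  filter_upwards [self_mem_nhdsWithin] with r hr using hgt r hr

theorem measurePreserving_update {ι X : Type*} [DecidableEq ι] [MeasurableSpace X]
    (μ : ι → Measure X) [∀ i, IsProbabilityMeasure (μ i)] (a : ι) :
    MeasurePreserving (fun z : (ι → X) × X => Function.update z.1 a z.2)
      ((Measure.infinitePi μ).prod (μ a)) (Measure.infinitePi μ) := by
  have hm : Measurable (fun z : (ι → X) × X => Function.update z.1 a z.2) := by
    refine measurable_pi_lambda _ fun i => ?_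
    by_cases h : i = a
    · subst h; simpa using measurable_snd
    · simpa [h] using (show Measurable fun z : (ι → X) × X => z.1 i by fun_prop)
  refine ⟨hm, Measure.eq_infinitePi _ fun s t ht => ?_⟩
  rw [Measure.map_apply hm (MeasurableSet.pi s.countable_toSet fun i _ => ht i)]
  have hpre : (fun z : (ι → X) × X => Function.update z.1 a z.2) ⁻¹' Set.pi s t =
      Set.pi (s.erase a : Finset ι) t ×ˢ (if a ∈ s then t a else univ) := by
    ext ⟨x, y⟩
    simp only [mem_preimage, Set.mem_pi, Finset.mem_coe, mem_prod, Finset.mem_erase]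
    constructor
    · intro h
      refine ⟨fun i hi => by simpa [hi.1] using h i hi.2, ?_⟩
      split_ifs with ha
      · simpa using h a ha
      · trivial
    · rintro ⟨h1, h2⟩ i hi
      by_cases hia : i = a
      · subst hia; simpa [hi] using h2
      · simpa [hia] using h1 i ⟨hia, hi⟩
  rw [hpre, Measure.prod_prod, Measure.infinitePi_pi _ fun i _ => ht i]
  split_ifs with ha
  · exact Finset.prod_erase_mul _ _ ha
  · rw [measure_univ, mul_one, Finset.erase_eq_of_notMem ha]

theorem measurePreserving_prodProdProdComm {α β γ δ : Type*} [MeasurableSpace α]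
    [MeasurableSpace β] [MeasurableSpace γ] [MeasurableSpace δ] (μ : Measure α) (ν : Measure β)
    (μ' : Measure γ) (ν' : Measure δ) [SFinite μ] [SFinite ν] [SFinite μ'] [SFinite ν'] :
    MeasurePreserving (fun z : (α × β) × (γ × δ) => ((z.1.1, z.2.1), (z.1.2, z.2.2)))
      ((μ.prod ν).prod (μ'.prod ν')) ((μ.prod μ').prod (ν.prod ν')) := by
  have h1 := measurePreserving_prodAssoc μ ν (μ'.prod ν')
  have h2 : MeasurePreserving (fun z : β × (γ × δ) => (z.2.1, (z.1, z.2.2)))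
      (ν.prod (μ'.prod ν')) (μ'.prod (ν.prod ν')) :=
    (measurePreserving_prodAssoc μ' ν ν').comp
      (((Measure.measurePreserving_swap (μ := ν) (ν := μ')).prod (MeasurePreserving.id ν')).comp
        (measurePreserving_prodAssoc ν μ' ν').symm)
  exact (measurePreserving_prodAssoc μ μ' (ν.prod ν')).symm.comp
    (((MeasurePreserving.id μ).prod h2).comp h1)

/-! ### Balls and regions in the torus -/

instance (m : ℕ) : IsProbabilityMeasure (volume : Measure (Torus m)) := ⟨by
  rw [← Set.pi_univ Set.univ, volume_pi_pi]; simp⟩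

namespace TorusMetric

variable {m : ℕ} (d : TorusMetric m)

theorem dist_self (x : Torus m) : d.dist x x = 0 := (d.dist_eq_zero_iff x x).2 rfl

theorem dist_nonneg (x y : Torus m) : 0 ≤ d.dist x y := by
  have h := d.dist_triangle x y x
  rw [d.dist_self, d.dist_comm y x] at h
  linarith

theorem continuous_dist_right (x : Torus m) : Continuous (d.dist x) :=
  d.continuous_dist.comp (Continuous.prodMk_right x)

theorem radius_le_iff {x : Torus m} {a r : ℝ} (h0 : 0 < a) (h1 : a < 1) :
    d.radius x a ≤ r ↔ a ≤ volume.real {y | d.dist x y ≤ r} := by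
  constructor
  · intro h
    have hne := (d.exists_ball x a h0 h1).imp fun r hr => hr.ge
    exact (le_measureReal_le_sInf (d.continuous_dist_right x).measurable hne).trans
      (measureReal_mono fun _ hy => le_trans hy h)
  · intro h
    refine csInf_le ⟨0, fun s (hs : a ≤ _) => le_of_not_gt fun hs0 => ?_⟩ h
    have hempty : {y | d.dist x y ≤ s} = ∅ :=
      eq_empty_of_forall_notMem fun y hy => (hs0.trans_le (d.dist_nonneg x y)).not_ge hy
    rw [hempty, measureReal_empty] at hs
    exact h0.not_ge hs

theorem ballOfVolume_of_lt_one {x : Torus m} {a : ℝ} (h1 : a < 1) :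
    d.ballOfVolume x a = {y | d.dist x y ≤ d.radius x a} :=
  Set.ext fun _ => or_iff_right (not_le.2 h1)

theorem ballOfVolume_of_one_le {x : Torus m} {a : ℝ} (h1 : 1 ≤ a) :
    d.ballOfVolume x a = univ :=
  eq_univ_of_forall fun _ => Or.inl h1

theorem volume_ballOfVolume (x : Torus m) {a : ℝ} (h0 : 0 < a) :
    volume.real (d.ballOfVolume x a) = min 1 a := by
  rcases le_or_gt 1 a with h1 | h1
  · rw [d.ballOfVolume_of_one_le h1, min_eq_left h1, probReal_univ]
  · rw [d.ballOfVolume_of_lt_one h1, min_eq_right h1.le]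
    refine le_antisymm ?_ ((d.radius_le_iff h0 h1).1 le_rfl)
    obtain ⟨r, hr⟩ := d.exists_ball x a h0 h1
    exact (measureReal_mono fun y hy => le_trans hy ((d.radius_le_iff h0 h1).2 hr.ge)).trans_eq hr

theorem ballOfVolume_mono (x : Torus m) {a b : ℝ} (h0 : 0 < a) (hab : a ≤ b) :
    d.ballOfVolume x a ⊆ d.ballOfVolume x b := by
  rcases le_or_gt 1 b with h1 | h1
  · rw [d.ballOfVolume_of_one_le h1]
    exact subset_univ _
  · rw [d.ballOfVolume_of_lt_one h1, d.ballOfVolume_of_lt_one (hab.trans_lt h1)]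
    exact fun y hy => le_trans hy <| (d.radius_le_iff h0 (hab.trans_lt h1)).2 <|
      hab.trans ((d.radius_le_iff (h0.trans_le hab) h1).1 le_rfl)

theorem radius_of_nonpos (x : Torus m) {a : ℝ} (ha : a ≤ 0) : d.radius x a = 0 := by
  simp only [radius, ha.trans measureReal_nonneg, ofPred_true, Real.sInf_univ]

theorem measurable_radius {a : ℝ} (h1 : a < 1) : Measurable fun x : Torus m => d.radius x a := by
  rcases le_or_gt a 0 with h0 | h0
  · simp only [d.radius_of_nonpos _ h0, measurable_const]
  refine measurable_of_Iic fun r => ?_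
  have hpre : (fun x : Torus m => d.radius x a) ⁻¹' Iic r =
      {x | a ≤ volume.real (Prod.mk x ⁻¹' {z : Torus m × Torus m | d.dist z.1 z.2 ≤ r})} :=
    Set.ext fun x => d.radius_le_iff h0 h1
  rw [hpre]
  refine measurableSet_le measurable_const (Measurable.ennreal_toReal ?_)
  exact measurable_measure_prodMk_left
    (isClosed_le d.continuous_dist continuous_const).measurableSet

theorem measurableSet_mem_ballOfVolume (a : ℝ) :
    MeasurableSet {z : Torus m × Torus m | z.2 ∈ d.ballOfVolume z.1 a} := by
  rcases le_or_gt 1 a with h1 | h1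
  · simp [d.ballOfVolume_of_one_le h1]
  · simp only [d.ballOfVolume_of_lt_one h1]
    exact measurableSet_le d.continuous_dist.measurable
      ((d.measurable_radius h1).comp measurable_fst)

theorem measurableSet_ballOfVolume (x : Torus m) (a : ℝ) : MeasurableSet (d.ballOfVolume x a) :=
  measurable_prodMk_left (d.measurableSet_mem_ballOfVolume a)

theorem exists_ball_subset {x : Torus m} {U : Set (Torus m)} (hU : U ∈ 𝓝 x) :
    ∃ δ > 0, {y | d.dist x y ≤ δ} ⊆ U := by
  obtain ⟨V, hVU, hV, hxV⟩ := mem_nhds_iff.1 hU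
  rcases Vᶜ.eq_empty_or_nonempty with hempty | hne
  · exact ⟨1, one_pos, by
      rw [univ_subset_iff.1 ((compl_empty_iff.1 hempty).symm.subset.trans hVU)]
      exact subset_univ _⟩
  · obtain ⟨z, hz, hmin⟩ := hV.isClosed_compl.isCompact.exists_isMinOn hne
      (d.continuous_dist_right x).continuousOn
    have hpos : 0 < d.dist x z := (d.dist_nonneg x z).lt_of_ne fun h =>
      hz ((d.dist_eq_zero_iff x z).1 h.symm ▸ hxV)
    refine ⟨d.dist x z / 2, half_pos hpos, fun y hy => hVU (by_contra fun hyV => ?_)⟩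
    exact ((hmin hyV).trans hy).not_gt (half_lt_self hpos)

theorem volume_ball_pos (x : Torus m) {r : ℝ} (hr : 0 < r) :
    0 < volume.real {y | d.dist x y ≤ r} := by
  have hopen : IsOpen {y | d.dist x y < r} := isOpen_lt (d.continuous_dist_right x) continuous_const
  have hpos := hopen.measure_pos volume ⟨x, (d.dist_self x).trans_lt hr⟩
  exact (ENNReal.toReal_pos hpos.ne' (measure_ne_top _ _)).trans_le
    (measureReal_mono fun y (hy : d.dist x y < r) => hy.le)

theorem exists_ballOfVolume_subset {x : Torus m} {U : Set (Torus m)} (hU : U ∈ 𝓝 x) :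
    ∃ a > 0, d.ballOfVolume x a ⊆ U := by
  obtain ⟨δ, hδ, hδU⟩ := d.exists_ball_subset hU
  have hvol := d.volume_ball_pos x hδ
  have hlt := half_lt_self hvol
  refine ⟨_, half_pos hvol, ?_⟩
  rw [d.ballOfVolume_of_lt_one (hlt.trans_le measureReal_le_one)]
  exact fun y hy => hδU <| le_trans hy <|
    (d.radius_le_iff (half_pos hvol) (hlt.trans_le measureReal_le_one)).2 hlt.le

end TorusMetric

theorem volume_hyperplane {m : ℕ} (i : Fin m) (c : UnitAddCircle) :
    volume {x : Torus m | x i = c} = 0 := by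
  have : NullSingletonClass (volume : Measure UnitAddCircle) := ⟨fun u => by
    rw [← Metric.closedBall_zero (x := u), AddCircle.volume_closedBall]; simp⟩
  exact Measure.pi_hyperplane (fun _ : Fin m => (volume : Measure UnitAddCircle)) i c

theorem region_mem_nhds {m k : ℕ} {ℓ : Fin m → Fin k} {x : Torus m} (hx : x ∈ region ℓ)
    (hface : ∀ i, x i ≠ ((((ℓ i : ℕ) : ℝ) / k : ℝ) : UnitAddCircle)) : region ℓ ∈ 𝓝 x := by
  refine set_pi_mem_nhds finite_univ fun i _ => ?_
  obtain ⟨y, hy, hyx⟩ := hx i trivial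
  have hlt : ((ℓ i : ℕ) : ℝ) / k < y := hy.1.lt_of_ne fun h => hface i (h ▸ hyx.symm)
  rw [← hyx]
  exact QuotientAddGroup.isOpenMap_coe.image_mem_nhds (Ico_mem_nhds hlt hy.2)

theorem ae_region_mem_nhds {m k : ℕ} (ℓ : Fin m → Fin k) :
    ∀ᵐ x : Torus m, x ∈ region ℓ → region ℓ ∈ 𝓝 x := by
  have hface : ∀ᵐ x : Torus m, ∀ i, x i ≠ ((((ℓ i : ℕ) : ℝ) / k : ℝ) : UnitAddCircle) :=
    ae_all_iff.2 fun i => ae_iff.2 (by simpa only [not_not] using volume_hyperplane i _)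
  filter_upwards [hface] with x hx hxℓ using region_mem_nhds hxℓ hx

namespace Model

variable (M : Model)

/-! ### The law of the position of a node -/

/-- The maximal density `max_ℓ ρ_ℓ`. -/
noncomputable def maxDensity : ℝ := ⨆ ℓ, M.ρ ℓ

theorem ρ_le_maxDensity (ℓ : M.Label) : M.ρ ℓ ≤ M.maxDensity :=
  le_ciSup (finite_range M.ρ).bddAbove ℓ

theorem exists_ρ_eq_maxDensity : ∃ ℓ, M.ρ ℓ = M.maxDensity := by
  have : Nonempty (Fin M.k) := ⟨⟨0, M.k_pos⟩⟩
  exact exists_eq_ciSup_of_finite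

theorem maxDensity_nonneg : 0 ≤ M.maxDensity := by
  obtain ⟨ℓ, hℓ⟩ := M.exists_ρ_eq_maxDensity
  exact (M.ρ_nonneg ℓ).trans_eq hℓ

theorem density_eq {x : Torus M.m} {ℓ : M.Label} (hx : x ∈ region ℓ) : M.density x = M.ρ ℓ := by
  rw [density, Finset.sum_eq_single ℓ, indicator_of_mem hx]
  · intro ℓ' _ hne
    exact indicator_of_notMem (fun h => hne ((existsUnique_region M.k_pos x).unique h hx)) _
  · simp

theorem density_le (x : Torus M.m) : M.density x ≤ M.maxDensity := by
  obtain ⟨ℓ, hℓ, -⟩ := existsUnique_region M.k_pos x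
  exact (M.density_eq hℓ).trans_le (M.ρ_le_maxDensity ℓ)

theorem nodeLaw_real_le {A : Set (Torus M.m)} (hA : MeasurableSet A) :
    M.nodeLaw.real A ≤ M.maxDensity * volume.real A := by
  rw [Measure.real, Measure.real, ← ENNReal.toReal_ofReal M.maxDensity_nonneg,
    ← ENNReal.toReal_mul]
  refine ENNReal.toReal_mono (ENNReal.mul_ne_top ENNReal.ofReal_ne_top (measure_ne_top _ _)) ?_
  rw [nodeLaw, withDensity_apply _ hA, ← setLIntegral_const]
  exact lintegral_mono fun x => ENNReal.ofReal_le_ofReal (M.density_le x)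

theorem nodeLaw_real_of_subset {ℓ : M.Label} {A : Set (Torus M.m)}
    (hA : MeasurableSet A) (hAℓ : A ⊆ region ℓ) : M.nodeLaw.real A = M.ρ ℓ * volume.real A := by
  rw [Measure.real, Measure.real, nodeLaw, withDensity_apply _ hA,
    setLIntegral_congr_fun (g := fun _ => ENNReal.ofReal (M.ρ ℓ)) hA
      (fun x hx => by simp only [M.density_eq (hAℓ hx)]),
    setLIntegral_const, ENNReal.toReal_mul, ENNReal.toReal_ofReal (M.ρ_nonneg ℓ)]

theorem nodeLaw_real_region (ℓ : M.Label) : M.nodeLaw.real (region ℓ) = M.q ℓ := by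
  rw [M.nodeLaw_real_of_subset (measurableSet_region ℓ) subset_rfl, Measure.real, volume_region,
    ENNReal.toReal_ofReal (by positivity), q]

/-- Pairs of points that do not lie in a common region; crossing links are the links in this set. -/
def crossing : Set (Torus M.m × Torus M.m) :=
  {z | ¬ ∃ ℓ : M.Label, z.1 ∈ region ℓ ∧ z.2 ∈ region ℓ}

theorem measurableSet_crossing : MeasurableSet M.crossing := by
  have hcompl : M.crossing = (⋃ ℓ : M.Label, region ℓ ×ˢ region ℓ)ᶜ := by
    ext z
    simp [crossing]
  rw [hcompl]
  exact (MeasurableSet.iUnion fun ℓ =>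
    (measurableSet_region ℓ).prod (measurableSet_region ℓ)).compl

theorem prodMk_preimage_crossing {ℓ : M.Label} {x : Torus M.m} (hx : x ∈ region ℓ) :
    Prod.mk x ⁻¹' M.crossing = (region ℓ)ᶜ := by
  ext y
  refine not_congr ⟨?_, fun hy => ⟨ℓ, hx, hy⟩⟩
  rintro ⟨ℓ', hx', hy⟩
  exact (existsUnique_region M.k_pos x).unique hx hx' ▸ hy

/-- The volume of the part of the ball of volume `a` around `x` outside the region of `x`; it bounds
the loss of a node at `x` to other regions. -/
noncomputable def outerVolume (x : Torus M.m) (a : ℝ) : ℝ :=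
  volume.real (M.metric.ballOfVolume x a ∩ Prod.mk x ⁻¹' M.crossing)

theorem outerVolume_nonneg (x : Torus M.m) (a : ℝ) : 0 ≤ M.outerVolume x a := measureReal_nonneg

theorem measurable_outerVolume (a : ℝ) : Measurable fun x => M.outerVolume x a :=
  (measurable_measure_prodMk_left
    ((M.metric.measurableSet_mem_ballOfVolume a).inter M.measurableSet_crossing)).ennreal_toReal

theorem outerVolume_mono (x : Torus M.m) {a b : ℝ} (h0 : 0 < a) (hab : a ≤ b) :
    M.outerVolume x a ≤ M.outerVolume x b :=
  measureReal_mono (inter_subset_inter_left _ (M.metric.ballOfVolume_mono x h0 hab))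

theorem outerVolume_le (x : Torus M.m) {a : ℝ} (h0 : 0 < a) : M.outerVolume x a ≤ a :=
  (measureReal_mono inter_subset_left).trans
    ((M.metric.volume_ballOfVolume x h0).trans_le (min_le_right _ _))

/-- Points whose ball of volume `r` leaves their region in positive volume: the thin neighbourhood
of the region boundaries outside which small spheres of influence are harmless. -/
def nearBoundary (r : ℝ) : Set (Torus M.m) := {x | 0 < M.outerVolume x r}

theorem measurableSet_nearBoundary (r : ℝ) : MeasurableSet (M.nearBoundary r) :=
  measurableSet_lt measurable_const (M.measurable_outerVolume r)

theorem notMem_nearBoundary {x : Torus M.m} {ℓ : M.Label} {r : ℝ} (hx : x ∈ region ℓ)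
    (hball : M.metric.ballOfVolume x r ⊆ region ℓ) : x ∉ M.nearBoundary r := by
  rw [nearBoundary, mem_ofPred_eq, outerVolume, M.prodMk_preimage_crossing hx,
    (disjoint_compl_right_iff_subset.2 hball).inter_eq, measureReal_empty]
  exact lt_irrefl 0

theorem nodeLaw_iInter_nearBoundary : M.nodeLaw (⋂ r > 0, M.nearBoundary r) = 0 := by
  refine withDensity_absolutelyContinuous _ _ ?_
  have hae : ∀ᵐ x : Torus M.m, ∀ ℓ : M.Label, x ∈ region ℓ → region ℓ ∈ 𝓝 x :=
    ae_all_iff.2 fun ℓ => ae_region_mem_nhds ℓ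
  refine measure_mono_null ?_ (ae_iff.1 hae)
  intro x hx hreg
  obtain ⟨ℓ, hxℓ, -⟩ := existsUnique_region M.k_pos x
  obtain ⟨r, hr, hball⟩ := M.metric.exists_ballOfVolume_subset (hreg ℓ hxℓ)
  exact M.notMem_nearBoundary hxℓ hball (mem_iInter₂.1 hx r hr)

theorem tendsto_nodeLaw_nearBoundary :
    Tendsto (fun r => M.nodeLaw.real (M.nearBoundary r)) (𝓝[>] 0) (𝓝 0) := by
  have hlim := tendsto_measure_biInter_gt (μ := M.nodeLaw) (a := (0 : ℝ)) (s := M.nearBoundary)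
    (fun r _ => (M.measurableSet_nearBoundary r).nullMeasurableSet)
    (fun r s hr hrs x hx => lt_of_lt_of_le hx (M.outerVolume_mono x hr hrs))
    ⟨1, one_pos, measure_ne_top _ _⟩
  rw [M.nodeLaw_iInter_nearBoundary] at hlim
  exact (ENNReal.tendsto_toReal ENNReal.zero_ne_top).comp hlim

theorem outerVolume_le_indicator_add (x : Torus M.m) {a r : ℝ} (ha : 0 < a) (hr : 0 < r) :
    M.outerVolume x a ≤ (M.nearBoundary r).indicator (fun _ => a) x + a ^ 2 / r := by
  have hsq : 0 ≤ a ^ 2 / r := by positivity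
  by_cases hx : x ∈ M.nearBoundary r
  · rw [indicator_of_mem hx]
    linarith [M.outerVolume_le x ha]
  · rw [indicator_of_notMem hx, zero_add]
    rcases le_or_gt a r with h | h
    · exact ((M.outerVolume_mono x ha h).trans (not_lt.1 hx)).trans hsq
    · refine (M.outerVolume_le x ha).trans ?_
      rw [le_div_iff₀ hr, sq]
      gcongr

theorem nodeLaw_real_ball_inter_crossing_le (x : Torus M.m) (a : ℝ) :
    M.nodeLaw.real (M.metric.ballOfVolume x a ∩ Prod.mk x ⁻¹' M.crossing) ≤
      M.maxDensity * M.outerVolume x a :=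
  M.nodeLaw_real_le ((M.metric.measurableSet_ballOfVolume x a).inter
    (measurable_prodMk_left M.measurableSet_crossing))

theorem outerVolume_eq {ℓ : M.Label} {x : Torus M.m} (hx : x ∈ region ℓ) (a : ℝ) :
    M.outerVolume x a = volume.real (M.metric.ballOfVolume x a \ region ℓ) := by
  rw [outerVolume, M.prodMk_preimage_crossing hx, sdiff_eq]

theorem nodeLaw_real_ball_inter_region {ℓ : M.Label} {x : Torus M.m} (hx : x ∈ region ℓ) {a : ℝ}
    (ha : 0 < a) : M.nodeLaw.real (M.metric.ballOfVolume x a ∩ region ℓ) =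
      M.ρ ℓ * (min 1 a - M.outerVolume x a) := by
  rw [M.nodeLaw_real_of_subset ((M.metric.measurableSet_ballOfVolume x a).inter
      (measurableSet_region ℓ)) inter_subset_right,
    ← M.metric.volume_ballOfVolume x ha, M.outerVolume_eq hx,
    ← measureReal_inter_add_sdiff (s := M.metric.ballOfVolume x a) (measurableSet_region ℓ),
    add_sub_cancel_right]

theorem abs_nodeLaw_real_ball_inter_sub_le {ℓ : M.Label} {x : Torus M.m} (hx : x ∈ region ℓ)
    {A : Set (Torus M.m)} (hA : region ℓ ⊆ A) {a : ℝ} (ha : 0 < a) :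
    |M.nodeLaw.real (M.metric.ballOfVolume x a ∩ A) - M.ρ ℓ * a| ≤
      M.maxDensity * (M.outerVolume x a + a ^ 2) := by
  set B := M.metric.ballOfVolume x a
  have hBm : MeasurableSet B := M.metric.measurableSet_ballOfVolume x a
  have hinner := M.nodeLaw_real_ball_inter_region hx ha
  have hlower : M.nodeLaw.real (B ∩ region ℓ) ≤ M.nodeLaw.real (B ∩ A) :=
    measureReal_mono (inter_subset_inter_right _ hA)
  have hupper : M.nodeLaw.real (B ∩ A) ≤
      M.nodeLaw.real (B ∩ region ℓ) + M.maxDensity * M.outerVolume x a := by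
    refine (measureReal_mono inter_subset_left).trans ?_
    rw [← measureReal_inter_add_sdiff (s := B) (measurableSet_region ℓ), M.outerVolume_eq hx]
    gcongr
    exact M.nodeLaw_real_le (hBm.diff (measurableSet_region ℓ))
  have hmin : a - a ^ 2 ≤ min 1 a := le_min (by nlinarith [sq_nonneg (a - 1)]) (by nlinarith)
  have hρ := M.ρ_nonneg ℓ
  have hout := M.outerVolume_nonneg x a
  have hloss : M.ρ ℓ * (M.outerVolume x a + a ^ 2) ≤
      M.maxDensity * (M.outerVolume x a + a ^ 2) := by
    gcongr
    exact M.ρ_le_maxDensity ℓ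
  rw [abs_sub_le_iff]
  constructor
  · have hcap : M.ρ ℓ * (min 1 a - M.outerVolume x a) ≤ M.ρ ℓ * a := by
      gcongr
      linarith [min_le_right 1 a]
    have hsq : 0 ≤ M.maxDensity * a ^ 2 := mul_nonneg M.maxDensity_nonneg (sq_nonneg a)
    linarith
  · have hfill : M.ρ ℓ * (a - a ^ 2 - M.outerVolume x a) ≤
        M.ρ ℓ * (min 1 a - M.outerVolume x a) := by gcongr
    linarith

/-! ### Links and in-degrees -/

/-- Replace the position of the node `s` and the coin of the pair `e`. Taking the mean over the
replacements is conditioning on all the other positions and coins. -/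
def resample (s : ℕ) (e : ℕ × ℕ) (z : M.Sample × (Torus M.m × Bool)) : M.Sample :=
  (Function.update z.1.1 s z.2.1, Function.update z.1.2 e z.2.2)

theorem measurePreserving_resample (s : ℕ) (e : ℕ × ℕ) :
    MeasurePreserving (M.resample s e) (M.law.prod (M.nodeLaw.prod M.coinLaw)) M.law := by
  have h := (measurePreserving_update (fun _ : ℕ => M.nodeLaw) s).prod
    (measurePreserving_update (fun _ : ℕ × ℕ => M.coinLaw) e)
  refine h.comp (f := fun z : M.Sample × (Torus M.m × Bool) => ((z.1.1, z.2.1), (z.1.2, z.2.2))) ?_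
  exact measurePreserving_prodProdProdComm _ _ _ _

theorem integral_resample {f : M.Sample → ℝ} (hf : Integrable f M.law) (s : ℕ) (e : ℕ × ℕ) :
    ∫ ω, f ω ∂M.law =
      ∫ ω, ∫ w, f (M.resample s e (ω, w)) ∂(M.nodeLaw.prod M.coinLaw) ∂M.law := by
  have hmp := M.measurePreserving_resample s e
  rw [← hmp.map_eq] at hf
  conv_lhs => rw [← hmp.map_eq]
  rw [integral_map hmp.aemeasurable hf.aestronglyMeasurable]
  exact integral_prod _ (hf.comp_measurable hmp.measurable)

theorem coinLaw_real_true : M.coinLaw.real {true} = M.p := by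
  simp [coinLaw, Measure.real, ENNReal.toReal_ofReal M.p_pos.le]

/-- The state at time `t` of the node `i`: its in-degree and its position. -/
noncomputable def state (ω : M.Sample) (t i : ℕ) : ℕ × Torus M.m := (inDeg (M.edges ω t) i, ω.1 i)

/-- The positions at which a new node is within the sphere of influence of a node in state `z` at
time `t` and forms with it a pair (target first) in `T`. -/
def hitSet (T : Set (Torus M.m × Torus M.m)) (t : ℕ) (z : ℕ × Torus M.m) : Set (Torus M.m) :=
  M.sphere z.2 z.1 t ∩ Prod.mk z.2 ⁻¹' T

theorem measurableSet_sphere (j t : ℕ) :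
    MeasurableSet {z : Torus M.m × Torus M.m | z.2 ∈ M.sphere z.1 j t} :=
  M.metric.measurableSet_mem_ballOfVolume _

theorem measurableSet_hitSet {T : Set (Torus M.m × Torus M.m)} (hT : MeasurableSet T) (t : ℕ)
    (z : ℕ × Torus M.m) : MeasurableSet (M.hitSet T t z) :=
  measurable_prodMk_left ((M.measurableSet_sphere z.1 t).inter hT)

/-- The event that the node `t + 1` links to the node `i` and their positions form a pair in `T`. -/
def linkEvent (T : Set (Torus M.m × Torus M.m)) (t i : ℕ) : Set M.Sample :=
  {ω | ω.1 (t + 1) ∈ M.hitSet T t (M.state ω t i) ∧ ω.2 (t + 1, i) = true}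

theorem mem_edges {ω : M.Sample} {t : ℕ} {e : ℕ × ℕ} (he : e ∈ M.edges ω t) :
    e.2 < e.1 ∧ e.1 ∈ Finset.Icc 1 t := by
  induction t with
  | zero => simp [edges] at he
  | succ t ih =>
    simp only [edges, Finset.mem_union, Finset.mem_image, Finset.mem_filter, Finset.mem_Icc] at he
    rcases he with he | ⟨i, ⟨hi, -⟩, rfl⟩
    · have := ih he
      rw [Finset.mem_Icc] at this ⊢
      omega
    · rw [Finset.mem_Icc]
      omega

theorem edges_congr {ω ω' : M.Sample} {t : ℕ} (hpos : ∀ s ≤ t, ω.1 s = ω'.1 s)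
    (hcoin : ∀ s ≤ t, ∀ i, ω.2 (s, i) = ω'.2 (s, i)) : M.edges ω t = M.edges ω' t := by
  classical
  induction t with
  | zero => rfl
  | succ t ih =>
    rw [edges, edges, ih (fun s hs => hpos s (by omega)) (fun s hs => hcoin s (by omega))]
    congr 2
    convert Finset.filter_congr fun i hi => ?_ using 1
    rw [hpos (t + 1) le_rfl, hcoin (t + 1) le_rfl, hpos i (by have := Finset.mem_Icc.1 hi; omega)]

theorem sum_edges_succ {β : Type*} [AddCommMonoid β] (ω : M.Sample) (t : ℕ) (φ : ℕ × ℕ → β) :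
    ∑ e ∈ M.edges ω (t + 1), φ e = ∑ e ∈ M.edges ω t, φ e +
      ∑ i ∈ Finset.Icc 1 t, (M.linkEvent univ t i).indicator (fun _ => φ (t + 1, i)) ω := by
  classical
  rw [edges, Finset.sum_union]
  · congr 1
    rw [Finset.sum_image (fun i _ j _ h => by simpa using h), Finset.sum_filter]
    simp only [indicator_apply, linkEvent, hitSet, state, preimage_univ, inter_univ, mem_ofPred_eq]
  · rw [Finset.disjoint_left]
    intro e he hnew
    have hle := (Finset.mem_Icc.1 (M.mem_edges he).2).2
    obtain ⟨i, -, rfl⟩ := Finset.mem_image.1 hnew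
    exact hle.not_gt t.lt_succ_self

theorem inDeg_eq_sum (E : Finset (ℕ × ℕ)) (i : ℕ) : inDeg E i = ∑ e ∈ E, if e.2 = i then 1 else 0 :=
  Finset.card_filter _ _

theorem inDeg_succ (ω : M.Sample) (t i : ℕ) :
    inDeg (M.edges ω (t + 1)) i = inDeg (M.edges ω t) i + ∑ j ∈ Finset.Icc 1 t,
      (M.linkEvent univ t j).indicator (fun _ => if j = i then 1 else 0) ω := by
  simp only [inDeg_eq_sum, sum_edges_succ]

theorem inDeg_self (ω : M.Sample) (t : ℕ) : inDeg (M.edges ω t) t = 0 := by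
  rw [inDeg, Finset.card_eq_zero, Finset.filter_eq_empty_iff]
  intro e he hte
  have := M.mem_edges he
  rw [Finset.mem_Icc] at this
  omega

theorem inDeg_le (ω : M.Sample) (t i : ℕ) : inDeg (M.edges ω t) i ≤ t := by
  refine (Finset.card_le_card_of_injOn (t := Finset.Icc 1 t) Prod.fst (fun e he => ?_)
    (fun e he e' he' h => ?_)).trans_eq (by simp)
  · exact (M.mem_edges (Finset.mem_filter.1 he).1).2
  · exact Prod.ext h ((Finset.mem_filter.1 he).2.trans (Finset.mem_filter.1 he').2.symm)

theorem state_succ_of_mem {ω : M.Sample} {t i : ℕ} (hi : i ∈ Finset.Icc 1 t)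
    (hω : ω ∈ M.linkEvent univ t i) :
    M.state ω (t + 1) i = ((M.state ω t i).1 + 1, (M.state ω t i).2) := by
  rw [state, inDeg_succ, Finset.sum_eq_single_of_mem i hi fun j _ hj => by simp [hj],
    indicator_of_mem hω, if_pos rfl, state]

theorem state_succ_of_notMem {ω : M.Sample} {t i : ℕ} (hi : i ∈ Finset.Icc 1 t)
    (hω : ω ∉ M.linkEvent univ t i) : M.state ω (t + 1) i = M.state ω t i := by
  rw [state, inDeg_succ, Finset.sum_eq_single_of_mem i hi fun j _ hj => by simp [hj],
    indicator_of_notMem hω, add_zero, state]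

theorem measurableSet_linkEvent_of_measurable_inDeg {T : Set (Torus M.m × Torus M.m)}
    (hT : MeasurableSet T) {t i : ℕ} (hdeg : Measurable fun ω : M.Sample => inDeg (M.edges ω t) i) :
    MeasurableSet (M.linkEvent T t i) := by
  have hset : MeasurableSet {w : ℕ × (Torus M.m × Torus M.m) | w.2.2 ∈ M.hitSet T t (w.1, w.2.1)} :=
    measurableSet_setOfPred.2 <| measurable_from_prod_countable_right fun j =>
      measurableSet_setOfPred.1 ((M.measurableSet_sphere j t).inter hT)
  have hpos : Measurable fun ω : M.Sample => (ω.1 i, ω.1 (t + 1)) := by fun_prop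
  have hcoin : Measurable fun ω : M.Sample => ω.2 (t + 1, i) := by fun_prop
  exact (hdeg.prodMk hpos hset).inter (hcoin (measurableSet_singleton true))

theorem measurable_inDeg (t i : ℕ) : Measurable fun ω : M.Sample => inDeg (M.edges ω t) i := by
  induction t generalizing i with
  | zero => exact measurable_const
  | succ t ih =>
    simp only [inDeg_succ]
    exact (ih i).add <| Finset.measurable_sum _ fun j _ => measurable_const.indicator
      (M.measurableSet_linkEvent_of_measurable_inDeg MeasurableSet.univ (ih j))

theorem measurable_state (t i : ℕ) : Measurable fun ω : M.Sample => M.state ω t i :=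
  (M.measurable_inDeg t i).prodMk (by fun_prop)

theorem measurableSet_linkEvent {T : Set (Torus M.m × Torus M.m)} (hT : MeasurableSet T)
    (t i : ℕ) : MeasurableSet (M.linkEvent T t i) :=
  M.measurableSet_linkEvent_of_measurable_inDeg hT (M.measurable_inDeg t i)

theorem state_resample {t i : ℕ} (hi : i ≤ t) (ω : M.Sample) (e : ℕ) (w : Torus M.m × Bool) :
    M.state (M.resample (t + 1) (t + 1, e) (ω, w)) t i = M.state ω t i := by
  have hpos : ∀ s ≤ t, (M.resample (t + 1) (t + 1, e) (ω, w)).1 s = ω.1 s := fun s hs =>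
    Function.update_of_ne (by omega) _ _
  have hcoin : ∀ s ≤ t, ∀ j, (M.resample (t + 1) (t + 1, e) (ω, w)).2 (s, j) = ω.2 (s, j) :=
    fun s hs j => Function.update_of_ne (by simp; omega) _ _
  rw [state, state, M.edges_congr hpos hcoin, hpos i hi]

theorem resample_mem_linkEvent_iff (T : Set (Torus M.m × Torus M.m)) {t i : ℕ} (hi : i ≤ t)
    (ω : M.Sample) (w : Torus M.m × Bool) :
    M.resample (t + 1) (t + 1, i) (ω, w) ∈ M.linkEvent T t i ↔
      w ∈ M.hitSet T t (M.state ω t i) ×ˢ {true} := by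
  rw [linkEvent, mem_ofPred_eq, M.state_resample hi, mem_prod, mem_singleton_iff]
  simp only [resample, Function.update_self]

/-! ### The mean profile -/

/-- The probability that a new node falls into `hitSet T t z`. -/
noncomputable def hitProb (T : Set (Torus M.m × Torus M.m)) (t : ℕ) (z : ℕ × Torus M.m) : ℝ :=
  M.nodeLaw.real (M.hitSet T t z)

theorem norm_hitProb_le_one (T : Set (Torus M.m × Torus M.m)) (t : ℕ) (z : ℕ × Torus M.m) :
    ‖M.hitProb T t z‖ ≤ 1 := by
  rw [hitProb, Real.norm_of_nonneg measureReal_nonneg]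
  exact measureReal_le_one

theorem measurable_hitProb {T : Set (Torus M.m × Torus M.m)} (hT : MeasurableSet T) (t : ℕ) :
    Measurable (M.hitProb T t) :=
  measurable_from_prod_countable_right fun j =>
    (measurable_measure_prodMk_left ((M.measurableSet_sphere j t).inter hT)).ennreal_toReal

theorem measurePreserving_position (t : ℕ) :
    MeasurePreserving (fun ω : M.Sample => ω.1 t) M.law M.nodeLaw :=
  (measurePreserving_eval_infinitePi (fun _ : ℕ => M.nodeLaw) t).comp measurePreserving_fst

/-- The mean profile of `G_t`: the expectation of the sum of the Dirac masses at the states of its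
nodes. Mean values of sums over the nodes are integrals against it. -/
noncomputable def profile (t : ℕ) : Measure (ℕ × Torus M.m) :=
  ∑ i ∈ Finset.Icc 1 t, M.law.map fun ω => M.state ω t i

section Observables

variable {M} {g : ℕ × Torus M.m → ℝ} {C : ℕ → ℝ}

theorem integrable_comp_state (hg : Measurable g) (hC : ∀ z, ‖g z‖ ≤ C z.1) (t i : ℕ) :
    Integrable (fun ω => g (M.state ω t i)) M.law := by
  refine .of_bound (hg.comp (M.measurable_state t i)).aestronglyMeasurable
    (∑ j ∈ Finset.range (t + 1), |C j|) (ae_of_all _ fun ω => ?_)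
  have hdeg : (M.state ω t i).1 ∈ Finset.range (t + 1) :=
    Finset.mem_range_succ_iff.2 (M.inDeg_le ω t i)
  exact (hC _).trans ((le_abs_self _).trans
    (Finset.single_le_sum (f := fun j => |C j|) (fun j _ => abs_nonneg (C j)) hdeg))

theorem integrable_profile (hg : Measurable g) (hC : ∀ z, ‖g z‖ ≤ C z.1) (t : ℕ) :
    Integrable g (M.profile t) :=
  integrable_finsetSum_measure.2 fun i _ =>
    (integrable_map_measure hg.aestronglyMeasurable (M.measurable_state t i).aemeasurable).2
      (integrable_comp_state hg hC t i)

theorem integral_profile (hg : Measurable g) (hC : ∀ z, ‖g z‖ ≤ C z.1) (t : ℕ) :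
    ∫ z, g z ∂M.profile t = ∑ i ∈ Finset.Icc 1 t, ∫ ω, g (M.state ω t i) ∂M.law := by
  rw [profile, integral_finsetSum_measure
    (integrable_finsetSum_measure.1 (integrable_profile hg hC t))]
  exact Finset.sum_congr rfl fun i _ =>
    integral_map (M.measurable_state t i).aemeasurable hg.aestronglyMeasurable

theorem setIntegral_linkEvent (hg : Measurable g) (hC : ∀ z, ‖g z‖ ≤ C z.1)
    {T : Set (Torus M.m × Torus M.m)} (hT : MeasurableSet T) {t i : ℕ} (hi : i ≤ t) :
    ∫ ω in M.linkEvent T t i, g (M.state ω t i) ∂M.law =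
      M.p * ∫ ω, g (M.state ω t i) * M.hitProb T t (M.state ω t i) ∂M.law := by
  classical
  have hE := M.measurableSet_linkEvent hT t i
  have hresample : ∀ ω w, (M.linkEvent T t i).indicator (fun ω' => g (M.state ω' t i))
      (M.resample (t + 1) (t + 1, i) (ω, w)) =
        (M.hitSet T t (M.state ω t i) ×ˢ {true}).indicator (fun _ => g (M.state ω t i)) w := by
    intro ω w
    simp only [indicator_apply, M.resample_mem_linkEvent_iff T hi, M.state_resample hi]
  rw [← integral_indicator hE,
    M.integral_resample ((integrable_comp_state hg hC t i).indicator hE) (t + 1) (t + 1, i),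
    ← integral_const_mul]
  refine integral_congr_ae (ae_of_all _ fun ω => ?_)
  simp only [hresample]
  rw [integral_indicator_const _ ((M.measurableSet_hitSet hT t _).prod (measurableSet_singleton _)),
    measureReal_prod_prod, coinLaw_real_true, smul_eq_mul, hitProb]
  ring

theorem sum_setIntegral_linkEvent (hg : Measurable g) (hC : ∀ z, ‖g z‖ ≤ C z.1)
    {T : Set (Torus M.m × Torus M.m)} (hT : MeasurableSet T) (t : ℕ) :
    ∑ i ∈ Finset.Icc 1 t, ∫ ω in M.linkEvent T t i, g (M.state ω t i) ∂M.law =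
      M.p * ∫ z, g z * M.hitProb T t z ∂M.profile t := by
  have hbound : ∀ z, ‖g z * M.hitProb T t z‖ ≤ C z.1 := fun z => by
    rw [norm_mul]
    exact (mul_le_of_le_one_right (norm_nonneg _) (M.norm_hitProb_le_one T t z)).trans (hC z)
  rw [integral_profile (hg.fun_mul (M.measurable_hitProb hT t)) hbound, Finset.mul_sum]
  exact Finset.sum_congr rfl fun i hi => setIntegral_linkEvent hg hC hT (Finset.mem_Icc.1 hi).2

theorem comp_state_succ (g : ℕ × Torus M.m → ℝ) {t i : ℕ} (hi : i ∈ Finset.Icc 1 t)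
    (ω : M.Sample) : g (M.state ω (t + 1) i) = g (M.state ω t i) +
      (M.linkEvent univ t i).indicator
        (fun ω => g ((M.state ω t i).1 + 1, (M.state ω t i).2) - g (M.state ω t i)) ω := by
  by_cases hω : ω ∈ M.linkEvent univ t i
  · rw [M.state_succ_of_mem hi hω, indicator_of_mem hω, add_sub_cancel]
  · rw [M.state_succ_of_notMem hi hω, indicator_of_notMem hω, add_zero]

theorem integral_profile_succ (hg : Measurable g) (hC : ∀ z, ‖g z‖ ≤ C z.1) (t : ℕ) :
    ∫ z, g z ∂M.profile (t + 1) = ∫ z, g z ∂M.profile t + ∫ x, g (0, x) ∂M.nodeLaw +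
      M.p * ∫ z, (g (z.1 + 1, z.2) - g z) * M.hitProb univ t z ∂M.profile t := by
  have hgain : Measurable fun z : ℕ × Torus M.m => g (z.1 + 1, z.2) - g z := by fun_prop
  have hgainC : ∀ z, ‖g (z.1 + 1, z.2) - g z‖ ≤ C (z.1 + 1) + C z.1 := fun z =>
    (norm_sub_le _ _).trans (add_le_add (hC _) (hC z))
  have hold : ∀ i ∈ Finset.Icc 1 t, ∫ ω, g (M.state ω (t + 1) i) ∂M.law =
      ∫ ω, g (M.state ω t i) ∂M.law + ∫ ω in M.linkEvent univ t i,
        (g ((M.state ω t i).1 + 1, (M.state ω t i).2) - g (M.state ω t i)) ∂M.law := by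
    intro i hi
    have hE := M.measurableSet_linkEvent .univ t i
    rw [← integral_indicator hE, ← integral_add (integrable_comp_state hg hC t i)
      ((integrable_comp_state (C := fun j => C (j + 1) + C j) hgain hgainC t i).indicator hE)]
    simp only [comp_state_succ g hi]
  have hnew : ∫ ω, g (M.state ω (t + 1) (t + 1)) ∂M.law = ∫ x, g (0, x) ∂M.nodeLaw := by
    simp only [state, inDeg_self]
    rw [← (M.measurePreserving_position (t + 1)).map_eq, integral_map (by fun_prop)
      (by fun_prop : Measurable fun x => g (0, x)).aestronglyMeasurable]
  rw [integral_profile hg hC, Finset.sum_Icc_succ_top (by omega), Finset.sum_congr rfl hold,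
    Finset.sum_add_distrib, ← integral_profile hg hC,
    sum_setIntegral_linkEvent (C := fun j => C (j + 1) + C j) hgain hgainC .univ, hnew]
  ring

end Observables

/-- The number of links of `G_t` whose pair of positions, target first, lies in `T`. -/
noncomputable def edgeCount (T : Set (Torus M.m × Torus M.m)) (ω : M.Sample) (t : ℕ) : ℝ :=
  ∑ e ∈ M.edges ω t, T.indicator (fun _ => 1) (ω.1 e.2, ω.1 e.1)

/-- The mean number of links of `G_t` whose pair of positions, target first, lies in `T`. -/
noncomputable def meanEdgeCount (T : Set (Torus M.m × Torus M.m)) (t : ℕ) : ℝ :=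
  ∫ ω, M.edgeCount T ω t ∂M.law

theorem edgeCount_nonneg (T : Set (Torus M.m × Torus M.m)) (ω : M.Sample) (t : ℕ) :
    0 ≤ M.edgeCount T ω t :=
  Finset.sum_nonneg fun _ _ => indicator_nonneg (fun _ _ => zero_le_one) _

theorem edgeCount_succ (T : Set (Torus M.m × Torus M.m)) (ω : M.Sample) (t : ℕ) :
    M.edgeCount T ω (t + 1) = M.edgeCount T ω t +
      ∑ i ∈ Finset.Icc 1 t, (M.linkEvent T t i).indicator (fun _ => 1) ω := by
  classical
  rw [edgeCount, sum_edges_succ, edgeCount]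
  congr 1
  refine Finset.sum_congr rfl fun i _ => ?_
  simp only [indicator_apply, linkEvent, hitSet, state, mem_ofPred_eq, mem_inter_iff,
    mem_preimage, mem_univ, and_true, ← ite_and]
  congr 1
  exact propext (by tauto)

theorem integrable_edgeCount {T : Set (Torus M.m × Torus M.m)} (hT : MeasurableSet T) (t : ℕ) :
    Integrable (fun ω => M.edgeCount T ω t) M.law := by
  induction t with
  | zero => simp [edgeCount, edges]
  | succ t ih =>
    simp only [edgeCount_succ]
    exact ih.add (integrable_finsetSum _ fun i _ =>
      (integrable_const 1).indicator (M.measurableSet_linkEvent hT t i))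

theorem meanEdgeCount_succ {T : Set (Torus M.m × Torus M.m)} (hT : MeasurableSet T) (t : ℕ) :
    M.meanEdgeCount T (t + 1) =
      M.meanEdgeCount T t + M.p * ∫ z, M.hitProb T t z ∂M.profile t := by
  have hlink : ∀ i ∈ Finset.Icc 1 t,
      Integrable ((M.linkEvent T t i).indicator fun _ => (1 : ℝ)) M.law := fun i _ =>
    (integrable_const 1).indicator (M.measurableSet_linkEvent hT t i)
  have hsum := sum_setIntegral_linkEvent (M := M) (g := fun _ => 1) (C := fun _ => 1)
    measurable_const (fun _ => norm_one.le) hT t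
  simp only [meanEdgeCount, edgeCount_succ]
  rw [integral_add (M.integrable_edgeCount hT t) (integrable_finsetSum _ hlink),
    integral_finsetSum _ hlink]
  simp only [one_mul] at hsum
  rw [← hsum]
  simp only [integral_indicator (M.measurableSet_linkEvent hT t _)]

/-! ### Weights -/

/-- The weight of a node of in-degree `j`: `t` times the volume, before truncation at `1`, of its
sphere of influence at time `t`. -/
def weight (j : ℕ) : ℝ := M.A₁ * j + M.A₂

theorem weight_pos (j : ℕ) : 0 < M.weight j :=
  add_pos_of_nonneg_of_pos (mul_nonneg M.A₁_pos.le j.cast_nonneg) M.A₂_pos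

theorem weight_zero : M.weight 0 = M.A₂ := by simp [weight]

theorem weight_succ (j : ℕ) : M.weight (j + 1) = M.weight j + M.A₁ := by
  simp only [weight, Nat.cast_add_one]
  ring

theorem hitProb_le {t : ℕ} (ht : 0 < t) (T : Set (Torus M.m × Torus M.m)) (z : ℕ × Torus M.m) :
    M.hitProb T t z ≤ M.maxDensity * (M.weight z.1 / t) := by
  have hvol : 0 < M.weight z.1 / t := div_pos (M.weight_pos _) (Nat.cast_pos.2 ht)
  calc M.hitProb T t z ≤ M.nodeLaw.real (M.sphere z.2 z.1 t) :=
        measureReal_mono inter_subset_left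
    _ ≤ M.maxDensity * volume.real (M.sphere z.2 z.1 t) :=
        M.nodeLaw_real_le (M.metric.measurableSet_ballOfVolume _ _)
    _ ≤ M.maxDensity * (M.weight z.1 / t) :=
        mul_le_mul_of_nonneg_left
          ((M.metric.volume_ballOfVolume z.2 hvol).trans_le (min_le_right _ _)) M.maxDensity_nonneg

theorem integrable_weight (t : ℕ) : Integrable (fun z => M.weight z.1) (M.profile t) :=
  integrable_profile (by fun_prop) (fun z => (Real.norm_of_nonneg (M.weight_pos z.1).le).le) t

theorem integrable_weight_sq (t : ℕ) : Integrable (fun z => M.weight z.1 ^ 2) (M.profile t) :=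
  integrable_profile (C := fun j => M.weight j ^ 2) (by fun_prop)
    (fun z => (Real.norm_of_nonneg (sq_nonneg _)).le) t

theorem integrable_hitProb {T : Set (Torus M.m × Torus M.m)} (hT : MeasurableSet T) (s t : ℕ) :
    Integrable (M.hitProb T s) (M.profile t) :=
  integrable_profile (C := fun _ => 1) (M.measurable_hitProb hT s) (M.norm_hitProb_le_one T s) t

theorem integrable_weight_mul_hitProb {T : Set (Torus M.m × Torus M.m)} (hT : MeasurableSet T)
    (s t : ℕ) : Integrable (fun z => M.weight z.1 * M.hitProb T s z) (M.profile t) :=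
  (M.integrable_weight t).mul_bdd (M.measurable_hitProb hT s).aestronglyMeasurable
    (ae_of_all _ (M.norm_hitProb_le_one T s))

theorem profile_zero : M.profile 0 = 0 := by simp [profile]

theorem mul_maxDensity_lt_one : M.p * M.A₁ * M.maxDensity < 1 := by
  obtain ⟨ℓ, hℓ⟩ := M.exists_ρ_eq_maxDensity
  exact hℓ ▸ M.subcritical ℓ

/-- The mean total weight of the nodes of `G_t` in `B`. -/
noncomputable def meanWeight (B : Set (Torus M.m)) (t : ℕ) : ℝ :=
  ∫ z in Prod.snd ⁻¹' B, M.weight z.1 ∂M.profile t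

theorem meanWeight_succ {B : Set (Torus M.m)} (hB : MeasurableSet B) (t : ℕ) :
    M.meanWeight B (t + 1) = M.meanWeight B t + M.A₂ * M.nodeLaw.real B +
      M.p * M.A₁ * ∫ z in Prod.snd ⁻¹' B, M.hitProb univ t z ∂M.profile t := by
  have hS : MeasurableSet (Prod.snd ⁻¹' B : Set (ℕ × Torus M.m)) := measurable_snd hB
  have hrec := integral_profile_succ (M := M) (C := M.weight)
    (g := (Prod.snd ⁻¹' B).indicator fun z => M.weight z.1)
    ((by fun_prop : Measurable fun z : ℕ × Torus M.m => M.weight z.1).indicator hS)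
    (fun z => (norm_indicator_le_norm_self _ _).trans_eq
      (Real.norm_of_nonneg (M.weight_pos z.1).le)) t
  have hnew : ∀ x : Torus M.m, (Prod.snd ⁻¹' B).indicator (fun z : ℕ × Torus M.m => M.weight z.1)
      (0, x) = B.indicator (fun _ => M.A₂) x := fun x => by
    rw [← M.weight_zero]
    rfl
  have hgain : ∀ z : ℕ × Torus M.m,
      ((Prod.snd ⁻¹' B).indicator (fun z => M.weight z.1) (z.1 + 1, z.2) -
        (Prod.snd ⁻¹' B).indicator (fun z => M.weight z.1) z) * M.hitProb univ t z =
      (Prod.snd ⁻¹' B).indicator (fun z => M.A₁ * M.hitProb univ t z) z := by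
    intro z
    by_cases hz : z.2 ∈ B
    · simp [hz, weight_succ]
    · simp [hz]
  simp only [hnew, hgain] at hrec
  rw [integral_indicator hS, integral_indicator hS, integral_indicator hS,
    integral_indicator_const _ hB, integral_const_mul, smul_eq_mul] at hrec
  rw [meanWeight, hrec, meanWeight]
  ring

theorem setIntegral_hitProb_le (B : Set (Torus M.m)) (t : ℕ) :
    ∫ z in Prod.snd ⁻¹' B, M.hitProb univ t z ∂M.profile t ≤
      M.maxDensity * (M.meanWeight B t / t) := by
  rcases t.eq_zero_or_pos with rfl | ht
  · simp [profile_zero]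
  rw [meanWeight, ← integral_div, ← integral_const_mul]
  exact setIntegral_mono (M.integrable_hitProb .univ t t).integrableOn
    (((M.integrable_weight t).integrableOn.div_const _).const_mul _) (M.hitProb_le ht univ)

theorem meanWeight_le {B : Set (Torus M.m)} (hB : MeasurableSet B) (t : ℕ) : M.meanWeight B t ≤
    M.A₂ / (1 - M.p * M.A₁ * M.maxDensity) * M.nodeLaw.real B * t := by
  have hcrit := sub_pos.2 M.mul_maxDensity_lt_one
  have hA₂ := M.A₂_pos
  set c := M.p * M.A₁ * M.maxDensity
  have hc : 0 ≤ c := mul_nonneg (mul_pos M.p_pos M.A₁_pos).le M.maxDensity_nonneg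
  set K := M.A₂ / (1 - c) * M.nodeLaw.real B with hK
  have hK0 : 0 ≤ K := by positivity
  induction t with
  | zero => simp [meanWeight, profile_zero]
  | succ t ih =>
    have hpA₁ := mul_pos M.p_pos M.A₁_pos
    have hdiv : M.meanWeight B t / t ≤ K := div_le_of_le_mul₀ t.cast_nonneg hK0 ih
    calc M.meanWeight B (t + 1)
        ≤ M.meanWeight B t + M.A₂ * M.nodeLaw.real B +
            M.p * M.A₁ * (M.maxDensity * (M.meanWeight B t / t)) := by
          rw [M.meanWeight_succ hB]
          gcongr
          exact M.setIntegral_hitProb_le B t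
      _ = M.meanWeight B t + M.A₂ * M.nodeLaw.real B + c * (M.meanWeight B t / t) := by ring
      _ ≤ K * t + M.A₂ * M.nodeLaw.real B + c * K := by gcongr
      _ = K * (t + 1 : ℕ) := by
          rw [hK, Nat.cast_add_one]
          field_simp
          ring

/-- The mean sum of the squared weights of the nodes of `G_t`. -/
noncomputable def meanSqWeight (t : ℕ) : ℝ := ∫ z, M.weight z.1 ^ 2 ∂M.profile t

theorem meanSqWeight_nonneg (t : ℕ) : 0 ≤ M.meanSqWeight t :=
  integral_nonneg fun _ => sq_nonneg _

theorem meanSqWeight_succ (t : ℕ) :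
    M.meanSqWeight (t + 1) = M.meanSqWeight t + M.A₂ ^ 2 +
      M.p * (2 * M.A₁ * ∫ z, M.weight z.1 * M.hitProb univ t z ∂M.profile t +
        M.A₁ ^ 2 * ∫ z, M.hitProb univ t z ∂M.profile t) := by
  have hrec := integral_profile_succ (M := M) (C := fun j => M.weight j ^ 2)
    (g := fun z => M.weight z.1 ^ 2) (by fun_prop)
    (fun z => (Real.norm_of_nonneg (sq_nonneg _)).le) t
  have hgain : ∀ z, (M.weight (z.1 + 1) ^ 2 - M.weight z.1 ^ 2) * M.hitProb univ t z =
      2 * M.A₁ * (M.weight z.1 * M.hitProb univ t z) + M.A₁ ^ 2 * M.hitProb univ t z := by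
    intro z
    rw [weight_succ]
    ring
  simp only [hgain, weight_zero, integral_const, probReal_univ, one_smul] at hrec
  rw [integral_add ((M.integrable_weight_mul_hitProb .univ t t).const_mul _)
    ((M.integrable_hitProb .univ t t).const_mul _), integral_const_mul, integral_const_mul] at hrec
  rw [meanSqWeight, hrec, meanSqWeight]

theorem integral_weight_mul_hitProb_le {t : ℕ} (ht : 0 < t) :
    ∫ z, M.weight z.1 * M.hitProb univ t z ∂M.profile t ≤
      M.maxDensity / t * M.meanSqWeight t := by
  rw [meanSqWeight, ← integral_const_mul]
  refine integral_mono (M.integrable_weight_mul_hitProb .univ t t)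
    ((M.integrable_weight_sq t).const_mul _) fun z => ?_
  calc M.weight z.1 * M.hitProb univ t z
      ≤ M.weight z.1 * (M.maxDensity * (M.weight z.1 / t)) :=
        mul_le_mul_of_nonneg_left (M.hitProb_le ht univ z) (M.weight_pos _).le
    _ = M.maxDensity / t * M.weight z.1 ^ 2 := by ring

theorem exists_meanSqWeight_succ_le : ∃ D : ℝ, ∀ t : ℕ, 0 < t → M.meanSqWeight (t + 1) ≤
    (1 + 2 * (M.p * M.A₁ * M.maxDensity) / t) * M.meanSqWeight t + D := by
  have hp := M.p_pos
  have hA₁ := M.A₁_pos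
  have hR := M.maxDensity_nonneg
  set K := M.A₂ / (1 - M.p * M.A₁ * M.maxDensity) * M.nodeLaw.real univ
  refine ⟨M.A₂ ^ 2 + M.p * M.A₁ ^ 2 * (M.maxDensity * K), fun t ht => ?_⟩
  have hhit : ∫ z, M.hitProb univ t z ∂M.profile t ≤ M.maxDensity * K := by
    rw [← setIntegral_univ, ← preimage_univ (f := Prod.snd)]
    refine (M.setIntegral_hitProb_le univ t).trans (mul_le_mul_of_nonneg_left ?_ hR)
    exact (div_le_iff₀ (Nat.cast_pos.2 ht)).2 (M.meanWeight_le .univ t)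
  calc M.meanSqWeight (t + 1)
      ≤ M.meanSqWeight t + M.A₂ ^ 2 + M.p * (2 * M.A₁ * (M.maxDensity / t * M.meanSqWeight t) +
          M.A₁ ^ 2 * (M.maxDensity * K)) := by
        rw [meanSqWeight_succ]
        gcongr
        exact M.integral_weight_mul_hitProb_le ht
    _ = _ := by ring

theorem tendsto_meanSqWeight_div_sq :
    Tendsto (fun t : ℕ => M.meanSqWeight t / (t : ℝ) ^ 2) atTop (𝓝 0) := by
  obtain ⟨D, hD⟩ := M.exists_meanSqWeight_succ_le
  refine tendsto_div_sq_zero_of_le M.meanSqWeight_nonneg (D := D)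
    (c := 2 * (M.p * M.A₁ * M.maxDensity)) (by linarith [M.mul_maxDensity_lt_one]) ?_
  filter_upwards [eventually_gt_atTop 0] with t ht using hD t ht

/-- The mean over `G_t` of the total volume of the parts of the spheres of influence that lie
outside the regions of their centres. -/
noncomputable def meanOuterVolume (t : ℕ) : ℝ :=
  ∫ z, M.outerVolume z.2 (M.weight z.1 / t) ∂M.profile t

theorem integrable_outerVolume (t : ℕ) :
    Integrable (fun z => M.outerVolume z.2 (M.weight z.1 / t)) (M.profile t) := by
  have hmeas : Measurable fun z : ℕ × Torus M.m => M.outerVolume z.2 (M.weight z.1 / t) :=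
    measurable_from_prod_countable_right fun j => M.measurable_outerVolume (M.weight j / t)
  refine integrable_profile (C := fun _ => 1) hmeas (fun z => ?_) t
  rw [Real.norm_of_nonneg (M.outerVolume_nonneg _ _)]
  exact measureReal_le_one

theorem meanOuterVolume_nonneg (t : ℕ) : 0 ≤ M.meanOuterVolume t :=
  integral_nonneg fun _ => M.outerVolume_nonneg _ _

theorem meanOuterVolume_le {r : ℝ} (hr : 0 < r) {t : ℕ} (ht : 0 < t) :
    M.meanOuterVolume t ≤
      M.meanWeight (M.nearBoundary r) t / t + M.meanSqWeight t / (t : ℝ) ^ 2 / r := by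
  have hN : MeasurableSet (Prod.snd ⁻¹' M.nearBoundary r : Set (ℕ × Torus M.m)) :=
    measurable_snd (M.measurableSet_nearBoundary r)
  have hweight := ((M.integrable_weight t).div_const (t : ℝ)).indicator hN
  have hsq := ((M.integrable_weight_sq t).div_const ((t : ℝ) ^ 2)).div_const r
  calc M.meanOuterVolume t
      ≤ ∫ z, ((Prod.snd ⁻¹' M.nearBoundary r).indicator (fun z => M.weight z.1 / t) z +
          M.weight z.1 ^ 2 / (t : ℝ) ^ 2 / r) ∂M.profile t := by
        refine integral_mono (M.integrable_outerVolume t) (hweight.add hsq) fun z => ?_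
        have hle := M.outerVolume_le_indicator_add z.2
          (div_pos (M.weight_pos z.1) (Nat.cast_pos.2 ht)) hr
        rw [div_pow] at hle
        exact hle
    _ = _ := by
        rw [integral_add hweight hsq, integral_indicator hN, integral_div, integral_div,
          integral_div, meanWeight, meanSqWeight]

theorem tendsto_meanOuterVolume : Tendsto M.meanOuterVolume atTop (𝓝 0) := by
  set K := M.A₂ / (1 - M.p * M.A₁ * M.maxDensity)
  refine tendsto_order.2 ⟨fun b hb => .of_forall fun t => hb.trans_le (M.meanOuterVolume_nonneg t),
    fun ε hε => ?_⟩
  obtain ⟨r, hrN, hr⟩ : ∃ r, K * M.nodeLaw.real (M.nearBoundary r) < ε / 2 ∧ 0 < r := by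
    have hlim := M.tendsto_nodeLaw_nearBoundary.const_mul K
    rw [mul_zero] at hlim
    exact ((hlim.eventually_lt_const (half_pos hε)).and self_mem_nhdsWithin).exists
  have hsq : Tendsto (fun t : ℕ => M.meanSqWeight t / (t : ℝ) ^ 2 / r) atTop (𝓝 0) := by
    simpa only [zero_div] using M.tendsto_meanSqWeight_div_sq.div_const r
  filter_upwards [hsq.eventually_lt_const (half_pos hε), eventually_gt_atTop 0] with t htsq ht
  have hnear : M.meanWeight (M.nearBoundary r) t / t ≤ K * M.nodeLaw.real (M.nearBoundary r) :=
    (div_le_iff₀ (Nat.cast_pos.2 ht)).2 (M.meanWeight_le (M.measurableSet_nearBoundary r) t)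
  linarith [M.meanOuterVolume_le hr ht]

/-! ### Means per region -/

theorem abs_hitProb_sub_le {ℓ : M.Label} {T : Set (Torus M.m × Torus M.m)}
    (hT : region ℓ ×ˢ region ℓ ⊆ T) {t : ℕ} (ht : 0 < t) {z : ℕ × Torus M.m}
    (hz : z.2 ∈ region ℓ) :
    |M.hitProb T t z - M.ρ ℓ * (M.weight z.1 / t)| ≤
      M.maxDensity * (M.outerVolume z.2 (M.weight z.1 / t) + (M.weight z.1 / t) ^ 2) :=
  M.abs_nodeLaw_real_ball_inter_sub_le hz (fun _ hy => hT ⟨hz, hy⟩)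
    (div_pos (M.weight_pos z.1) (Nat.cast_pos.2 ht))

theorem abs_setIntegral_hitProb_sub_le {ℓ : M.Label} {T : Set (Torus M.m × Torus M.m)}
    (hT : MeasurableSet T) (hsub : region ℓ ×ˢ region ℓ ⊆ T) {t : ℕ} (ht : 0 < t) :
    |∫ z in Prod.snd ⁻¹' region ℓ, M.hitProb T t z ∂M.profile t -
        M.ρ ℓ * (M.meanWeight (region ℓ) t / t)| ≤
      M.maxDensity * (M.meanOuterVolume t + M.meanSqWeight t / (t : ℝ) ^ 2) := by
  have hS : MeasurableSet (Prod.snd ⁻¹' region ℓ : Set (ℕ × Torus M.m)) :=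
    measurable_snd (measurableSet_region ℓ)
  have hsq : Integrable (fun z => (M.weight z.1 / t) ^ 2) (M.profile t) := by
    simpa only [div_pow] using (M.integrable_weight_sq t).div_const ((t : ℝ) ^ 2)
  have herr : Integrable (fun z => M.maxDensity *
      (M.outerVolume z.2 (M.weight z.1 / t) + (M.weight z.1 / t) ^ 2)) (M.profile t) :=
    ((M.integrable_outerVolume t).add hsq).const_mul _
  have hweight : Integrable (fun z => M.ρ ℓ * (M.weight z.1 / t)) (M.profile t) :=
    ((M.integrable_weight t).div_const _).const_mul _
  calc |∫ z in Prod.snd ⁻¹' region ℓ, M.hitProb T t z ∂M.profile t -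
        M.ρ ℓ * (M.meanWeight (region ℓ) t / t)|
      = ‖∫ z in Prod.snd ⁻¹' region ℓ,
          (M.hitProb T t z - M.ρ ℓ * (M.weight z.1 / t)) ∂M.profile t‖ := by
        rw [integral_sub (M.integrable_hitProb hT t t).integrableOn hweight.integrableOn,
          integral_const_mul, integral_div, meanWeight, Real.norm_eq_abs]
    _ ≤ ∫ z in Prod.snd ⁻¹' region ℓ, M.maxDensity *
          (M.outerVolume z.2 (M.weight z.1 / t) + (M.weight z.1 / t) ^ 2) ∂M.profile t :=
        norm_integral_le_of_norm_le herr.integrableOn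
          (ae_restrict_of_forall_mem hS fun z hz => M.abs_hitProb_sub_le hsub ht hz)
    _ ≤ ∫ z, M.maxDensity *
          (M.outerVolume z.2 (M.weight z.1 / t) + (M.weight z.1 / t) ^ 2) ∂M.profile t :=
        setIntegral_le_integral herr (ae_of_all _ fun z => mul_nonneg M.maxDensity_nonneg
          (add_nonneg (M.outerVolume_nonneg _ _) (sq_nonneg _)))
    _ = M.maxDensity * (M.meanOuterVolume t + M.meanSqWeight t / (t : ℝ) ^ 2) := by
        rw [integral_const_mul, integral_add (M.integrable_outerVolume t) hsq, meanOuterVolume,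
          meanSqWeight, ← integral_div]
        simp only [div_pow]

theorem tendsto_setIntegral_hitProb_sub {ℓ : M.Label} {T : Set (Torus M.m × Torus M.m)}
    (hT : MeasurableSet T) (hsub : region ℓ ×ˢ region ℓ ⊆ T) :
    Tendsto (fun t : ℕ => ∫ z in Prod.snd ⁻¹' region ℓ, M.hitProb T t z ∂M.profile t -
      M.ρ ℓ * (M.meanWeight (region ℓ) t / t)) atTop (𝓝 0) := by
  have herr : Tendsto (fun t : ℕ => M.maxDensity *
      (M.meanOuterVolume t + M.meanSqWeight t / (t : ℝ) ^ 2)) atTop (𝓝 0) := by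
    simpa only [add_zero, mul_zero] using
      (M.tendsto_meanOuterVolume.add M.tendsto_meanSqWeight_div_sq).const_mul M.maxDensity
  refine squeeze_zero_norm' ?_ herr
  filter_upwards [eventually_gt_atTop 0] with t ht
  exact M.abs_setIntegral_hitProb_sub_le hT hsub ht

theorem tendsto_meanWeight_region_div (ℓ : M.Label) :
    Tendsto (fun t : ℕ => M.meanWeight (region ℓ) t / t) atTop
      (𝓝 (M.A₂ * M.q ℓ / (1 - M.p * M.A₁ * M.ρ ℓ))) := by
  refine tendsto_div_of_tendsto_sub (M.subcritical ℓ) ?_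
  have hlim := ((M.tendsto_setIntegral_hitProb_sub (ℓ := ℓ) .univ (subset_univ _)).const_mul
    (M.p * M.A₁)).const_add (M.A₂ * M.q ℓ)
  rw [mul_zero, add_zero] at hlim
  refine hlim.congr fun t => ?_
  rw [M.meanWeight_succ (measurableSet_region ℓ), nodeLaw_real_region]
  ring

theorem setIntegral_hitProb_prod (B : Set (Torus M.m)) (s t : ℕ) :
    ∫ z in Prod.snd ⁻¹' B, M.hitProb (B ×ˢ B) s z ∂M.profile t =
      ∫ z, M.hitProb (B ×ˢ B) s z ∂M.profile t := by
  refine setIntegral_eq_integral_of_forall_compl_eq_zero fun z (hz : z.2 ∉ B) => ?_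
  rw [hitProb, hitSet, mk_preimage_prod_right_eq_empty hz, inter_empty, measureReal_empty]

theorem tendsto_meanEdgeCount_region_div (ℓ : M.Label) :
    Tendsto (fun t : ℕ => M.meanEdgeCount (region ℓ ×ˢ region ℓ) t / t) atTop
      (𝓝 (M.p * M.ρ ℓ * M.A₂ / (1 - M.p * M.ρ ℓ * M.A₁) * M.q ℓ)) := by
  have hT := (measurableSet_region ℓ).prod (measurableSet_region ℓ)
  have hdiff : ∀ t : ℕ, M.meanEdgeCount (region ℓ ×ˢ region ℓ) (t + 1) -
      (1 + 0 / t) * M.meanEdgeCount (region ℓ ×ˢ region ℓ) t =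
      M.p * ∫ z in Prod.snd ⁻¹' region ℓ, M.hitProb (region ℓ ×ˢ region ℓ) t z ∂M.profile t := by
    intro t
    rw [M.meanEdgeCount_succ hT, setIntegral_hitProb_prod]
    ring
  have hlim := ((M.tendsto_setIntegral_hitProb_sub hT subset_rfl).add
    ((M.tendsto_meanWeight_region_div ℓ).const_mul (M.ρ ℓ))).const_mul M.p
  convert tendsto_div_of_tendsto_sub zero_lt_one (hlim.congr fun t => ?_) using 2
  · rw [zero_add, sub_zero, div_one, mul_right_comm M.p M.A₁]
    ring
  · rw [hdiff, sub_add_cancel]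

theorem hitProb_crossing_le (t : ℕ) (z : ℕ × Torus M.m) : M.hitProb M.crossing t z ≤
    M.maxDensity * M.outerVolume z.2 (M.weight z.1 / t) :=
  M.nodeLaw_real_ball_inter_crossing_le _ _

theorem tendsto_meanEdgeCount_crossing_div :
    Tendsto (fun t : ℕ => M.meanEdgeCount M.crossing t / t) atTop (𝓝 0) := by
  have hε : Tendsto (fun t => M.p * (M.maxDensity * M.meanOuterVolume t)) atTop (𝓝 0) := by
    simpa only [mul_zero] using
      (M.tendsto_meanOuterVolume.const_mul M.maxDensity).const_mul M.p
  refine tendsto_div_zero_of_le (fun t => integral_nonneg fun ω => M.edgeCount_nonneg _ ω t)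
    zero_lt_one hε (.of_forall fun t => ?_)
  rw [zero_div, add_zero, one_mul, M.meanEdgeCount_succ M.measurableSet_crossing]
  gcongr
  · exact M.p_pos.le
  rw [meanOuterVolume, ← integral_const_mul]
  exact integral_mono (M.integrable_hitProb M.measurableSet_crossing t t)
    ((M.integrable_outerVolume t).const_mul _) (M.hitProb_crossing_le t)

/-! ### Asymptotics of the counts -/

theorem aas_of_ae_eventually {E : ℕ → Set M.Sample} (hE : ∀ n, MeasurableSet (E n))
    (h : ∀ᵐ ω ∂M.law, ∀ᶠ n in atTop, ω ∈ E n) : M.AAS E := by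
  have hlim := tendsto_measure_of_ae_tendsto_indicator_of_isFiniteMeasure (μ := M.law)
    (A := univ) atTop .univ hE (by simpa only [mem_univ, iff_true] using h)
  rwa [measure_univ] at hlim

theorem aas_le_mul_of_tendsto_integral_div {X : ℕ → M.Sample → ℝ} (hX0 : ∀ n ω, 0 ≤ X n ω)
    (hX : ∀ n, Integrable (X n) M.law)
    (hlim : Tendsto (fun n : ℕ => (∫ ω, X n ω ∂M.law) / n) atTop (𝓝 0)) {ε : ℝ} (hε : 0 < ε) :
    M.AAS fun n => {ω | X n ω ≤ ε * n} := by
  have hlower : Tendsto (fun n : ℕ => ENNReal.ofReal (1 - (∫ ω, X n ω ∂M.law) / n / ε)) atTop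
      (𝓝 1) := by
    simpa using ENNReal.tendsto_ofReal ((hlim.div_const ε).const_sub 1)
  refine tendsto_of_tendsto_of_tendsto_of_le_of_le' hlower tendsto_const_nhds ?_
    (.of_forall fun n => prob_le_one)
  filter_upwards [eventually_gt_atTop 0] with n hn
  have : (0 : ℝ) < n := Nat.cast_pos.2 hn
  have hmarkov : M.law.real {ω | ε * n ≤ X n ω} ≤ (∫ ω, X n ω ∂M.law) / n / ε := by
    rw [div_div, le_div_iff₀ (by positivity), mul_comm, mul_comm (n : ℝ)]
    exact mul_meas_ge_le_integral_of_nonneg (ae_of_all _ (hX0 n)) (hX n) _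
  have hcover : 1 ≤ M.law.real {ω | X n ω ≤ ε * n} + M.law.real {ω | ε * n ≤ X n ω} := by
    have hunion : {ω | X n ω ≤ ε * n} ∪ {ω | ε * n ≤ X n ω} = univ :=
      eq_univ_of_forall fun ω => le_total (X n ω) (ε * n)
    simpa only [hunion, probReal_univ] using
      measureReal_union_le (μ := M.law) {ω | X n ω ≤ ε * n} {ω | ε * n ≤ X n ω}
  rw [ENNReal.ofReal_le_iff_le_toReal (measure_ne_top _ _)]
  change _ ≤ M.law.real _
  linarith

theorem crossingEdgeCount_eq (ω : M.Sample) (n : ℕ) :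
    (M.crossingEdgeCount ω n : ℝ) = M.edgeCount M.crossing ω n := by
  classical
  simp only [crossingEdgeCount, edgeCount, indicator_apply, Finset.sum_boole, crossing,
    mem_ofPred_eq, and_comm]

theorem innerEdgeCount_eq (ω : M.Sample) (n : ℕ) (ℓ : M.Label) :
    (M.innerEdgeCount ω n ℓ : ℝ) = M.edgeCount (region ℓ ×ˢ region ℓ) ω n := by
  classical
  simp only [innerEdgeCount, edgeCount, indicator_apply, Finset.sum_boole, mem_prod, and_comm]

theorem aas_crossingEdgeCount_le {ε : ℝ} (hε : 0 < ε) :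
    M.AAS fun n => {ω | (M.crossingEdgeCount ω n : ℝ) ≤ ε * n} := by
  simp only [crossingEdgeCount_eq]
  exact M.aas_le_mul_of_tendsto_integral_div (fun n ω => M.edgeCount_nonneg _ ω n)
    (M.integrable_edgeCount M.measurableSet_crossing) M.tendsto_meanEdgeCount_crossing_div hε

theorem ae_forall_position_notMem {B : Set (Torus M.m)} (hB : M.nodeLaw B = 0) :
    ∀ᵐ ω ∂M.law, ∀ i, ω.1 i ∉ B :=
  ae_all_iff.2 fun i =>
    (M.measurePreserving_position i).quasiMeasurePreserving.ae (measure_eq_zero_iff_ae_notMem.1 hB)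

theorem nodeLaw_region_eq_zero {ℓ : M.Label} (hq : M.q ℓ = 0) : M.nodeLaw (region ℓ) = 0 := by
  rwa [← nodeLaw_real_region, measureReal_eq_zero_iff] at hq

theorem integrable_innerEdgeCount (n : ℕ) (ℓ : M.Label) :
    Integrable (fun ω => (M.innerEdgeCount ω n ℓ : ℝ)) M.law := by
  simp only [innerEdgeCount_eq]
  exact M.integrable_edgeCount ((measurableSet_region ℓ).prod (measurableSet_region ℓ)) n

theorem isEquivalent_integral_innerEdgeCount (ℓ : M.Label) :
    Asymptotics.IsEquivalent atTop
      (fun n : ℕ => ∫ ω, (M.innerEdgeCount ω n ℓ : ℝ) ∂M.law)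
      (fun n : ℕ => M.p * M.ρ ℓ * M.A₂ / (1 - M.p * M.ρ ℓ * M.A₁) * M.q ℓ * n) := by
  rcases eq_or_ne (M.q ℓ) 0 with hq | hq
  · have hzero : ∀ n : ℕ, ∫ ω, (M.innerEdgeCount ω n ℓ : ℝ) ∂M.law = 0 := fun n => by
      refine integral_eq_zero_of_ae ?_
      filter_upwards [M.ae_forall_position_notMem (M.nodeLaw_region_eq_zero hq)] with ω hω
      simp [innerEdgeCount, hω]
    simp only [hzero, hq, mul_zero, zero_mul]
    exact .refl
  · refine isEquivalent_mul_natCast_of_tendsto_div ?_ ?_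
    · have hsub : 1 - M.p * M.ρ ℓ * M.A₁ ≠ 0 := by linarith [M.subcritical ℓ]
      have hρ : M.ρ ℓ ≠ 0 := left_ne_zero_of_mul hq
      have := M.p_pos.ne'
      have := M.A₂_pos.ne'
      positivity
    · simp only [innerEdgeCount_eq]
      exact M.tendsto_meanEdgeCount_region_div ℓ

theorem nodeCount_eq (ω : M.Sample) (n : ℕ) (ℓ : M.Label) :
    (M.nodeCount ω n ℓ : ℝ) = ∑ i ∈ Finset.Icc 1 n, (region ℓ).indicator 1 (ω.1 i) := by
  classical
  simp only [nodeCount, indicator_apply, Pi.one_apply, Finset.sum_boole]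

theorem measurable_nodeCount (n : ℕ) (ℓ : M.Label) :
    Measurable fun ω : M.Sample => (M.nodeCount ω n ℓ : ℝ) := by
  simp only [nodeCount_eq]
  exact Finset.measurable_fun_sum _ fun i _ =>
    (measurable_one.indicator (measurableSet_region ℓ)).comp
      (M.measurePreserving_position i).measurable

theorem ae_tendsto_nodeCount_div (ℓ : M.Label) :
    ∀ᵐ ω ∂M.law, Tendsto (fun n : ℕ => (M.nodeCount ω n ℓ : ℝ) / n) atTop (𝓝 (M.q ℓ)) := by
  have hf : Measurable ((region ℓ).indicator (1 : Torus M.m → ℝ)) :=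
    measurable_one.indicator (measurableSet_region ℓ)
  have hpos : ∀ i, MeasurePreserving (fun v : ℕ → Torus M.m => v i)
      (Measure.infinitePi fun _ => M.nodeLaw) M.nodeLaw :=
    measurePreserving_eval_infinitePi fun _ => M.nodeLaw
  have hslln := ProbabilityTheory.strong_law_ae_real
    (μ := Measure.infinitePi fun _ : ℕ => M.nodeLaw)
    (fun i v => (region ℓ).indicator 1 (v (i + 1)))
    ((hpos 1).integrable_comp_of_integrable
      ((integrable_const (1 : ℝ)).indicator (measurableSet_region ℓ)))
    (fun i j hij => (ProbabilityTheory.iIndepFun_infinitePi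
      (P := fun _ : ℕ => M.nodeLaw) (X := fun _ => (region ℓ).indicator 1)
        fun _ => hf).indepFun (Nat.succ_injective.ne hij))
    (fun i => ProbabilityTheory.IdentDistrib.comp ⟨(hpos (i + 1)).aemeasurable,
      (hpos 1).aemeasurable, by rw [(hpos (i + 1)).map_eq, (hpos 1).map_eq]⟩ hf)
  have hmean : ∫ v, (region ℓ).indicator 1 (v (0 + 1)) ∂(Measure.infinitePi fun _ => M.nodeLaw) =
      M.q ℓ := by
    have hmap := integral_map (hpos 1).aemeasurable hf.aestronglyMeasurable
    rw [(hpos 1).map_eq, integral_indicator_one (measurableSet_region ℓ),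
      nodeLaw_real_region] at hmap
    exact hmap.symm
  rw [hmean] at hslln
  filter_upwards [(measurePreserving_fst (ν := Measure.infinitePi fun _ : ℕ × ℕ =>
    M.coinLaw)).quasiMeasurePreserving.ae hslln] with ω hω
  refine hω.congr fun n => ?_
  rw [nodeCount_eq, Finset.range_eq_Ico,
    Finset.sum_Ico_add' (fun i => (region ℓ).indicator 1 (ω.1 i)), zero_add]
  rfl

theorem ae_eventually_abs_nodeCount_sub_le (ℓ : M.Label) {ε : ℝ} (hε : 0 < ε) :
    ∀ᵐ ω ∂M.law, ∀ᶠ n : ℕ in atTop,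
      |(M.nodeCount ω n ℓ : ℝ) - M.q ℓ * n| ≤ ε * (M.q ℓ * n) := by
  rcases eq_or_ne (M.q ℓ) 0 with hq | hq
  · filter_upwards [M.ae_forall_position_notMem (M.nodeLaw_region_eq_zero hq)] with ω hω
    simp [nodeCount, hω, hq]
  · filter_upwards [M.ae_tendsto_nodeCount_div ℓ] with ω hω
    have hequiv := (isEquivalent_mul_natCast_of_tendsto_div hq hω).isLittleO.def hε
    have hq0 : 0 ≤ M.q ℓ := mul_nonneg (M.ρ_nonneg ℓ) (by positivity)
    filter_upwards [hequiv] with n hn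
    rwa [Real.norm_of_nonneg (mul_nonneg hq0 n.cast_nonneg), Pi.sub_apply, Real.norm_eq_abs] at hn

theorem aas_nodeCount {ε : ℝ} (hε : 0 < ε) :
    M.AAS fun n => {ω | ∀ ℓ : M.Label,
      |(M.nodeCount ω n ℓ : ℝ) - M.q ℓ * n| ≤ ε * (M.q ℓ * n)} := by
  refine M.aas_of_ae_eventually (fun n => ?_) ?_
  · simp only [ofPred_forall]
    exact .iInter fun ℓ => measurableSet_le
      ((M.measurable_nodeCount n ℓ).sub_const _).abs measurable_const
  · filter_upwards [ae_all_iff.2 fun ℓ => M.ae_eventually_abs_nodeCount_sub_le ℓ hε] with ω hω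
    exact eventually_all.2 hω

end Model
end SPA

theorem theorem3 (M : SPA.Model) :
    (∀ ε : ℝ, 0 < ε →
      M.AAS fun n => {ω | ∀ ℓ : M.Label,
        |(M.nodeCount ω n ℓ : ℝ) - M.q ℓ * n| ≤ ε * (M.q ℓ * n)}) ∧
    (∀ ℓ : M.Label,
      (∀ n : ℕ, Integrable (fun ω => (M.innerEdgeCount ω n ℓ : ℝ)) M.law) ∧
      Asymptotics.IsEquivalent atTop
        (fun n : ℕ => ∫ ω, (M.innerEdgeCount ω n ℓ : ℝ) ∂M.law)
        (fun n : ℕ => M.p * M.ρ ℓ * M.A₂ / (1 - M.p * M.ρ ℓ * M.A₁) * M.q ℓ * n)) ∧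
    (∀ ε : ℝ, 0 < ε →
      M.AAS fun n => {ω | (M.crossingEdgeCount ω n : ℝ) ≤ ε * n}) :=
  ⟨fun _ hε => M.aas_nodeCount hε,
    fun ℓ => ⟨fun n => M.integrable_innerEdgeCount n ℓ, M.isEquivalent_integral_innerEdgeCount ℓ⟩,
    fun _ hε => M.aas_crossingEdgeCount_le hε⟩
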